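/- On $\mathbb{R}^n\times\mathbb{R}$ consider the vector fields $X_j=\partial_{x_j}$, $U_j=x_j\partial_u$ ($1\le j\le n$). For a tangent vector $v$ at $p$ let $\|v\|_p^2=\inf\{\sum_j(\alpha_j^2+\beta_j^2): v=\sum_j(\alpha_jX_j(p)+\beta_jU_j(p))\}$ (with $\inf\varnothing=\infty$). A horizontal curve is an absolutely continuous curve $\gamma:[0,1]\to\mathbb{R}^n\times\mathbb{R}$ with $\dot\gamma(t)\in\mathrm{span}\{X_j(\gamma(t)),U_j(\gamma(t))\}$ for almost every $t$; the length of a curve is $L(\gamma)=\int_0^1\|\dot\gamma(t)\|_{\gamma(t)}\,dt$, and $d_{CC}(p,q)$ is the infimum of $L(\gamma)$ over the horizontal curves $\gamma$ from $p$ to $q$. A geodesic is a curve $\gamma=(\gamma_{(1)},\gamma_{(2)})$ on $[0,1]$ that solves the Euler-Lagrange equations of the energy $\int_0^1\|\dot\gamma\|_\gamma^2\,dt$, namely $\ddot\gamma_{(1)}+k^2\gamma_{(1)}=0$, $\dot k=0$, where $\dot\gamma_{(2)}=k|\gamma_{(1)}|^2$. For $b\ne0$ and $c\in\mathbb{R}^n$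 let $\gamma^{b,c}$ be the curve starting in $(x,0)$ given by $$\gamma^{b,c}_{(1)}(t)=\frac{c}{b}\sin(bt)+x\cos(bt),\qquad \gamma^{b,c}_{(2)}(t)=\frac{|c|^2}{b}\Big(\frac t2-\frac{\sin(2bt)}{4b}\Big)+\frac{x\cdot c}{b}\sin^2(bt)+|x|^2b\Big(\frac t2+\frac{\sin(2bt)}{4b}\Big),$$ and let $\hat\mu(b)=\frac{b}{\cos^2b}+\tan b$ for $\cos b\ne0$. **Theorem.** Let $x\in\mathbb{R}^n$, $x\neq0$, and $u>0$. The geodesics connecting $(x,0)$ and $(x,u)$ are exactly the following. 1. For each solution $b\in\mathbb{R}$, $\cos\frac b2\ne0$, of $$\frac{u}{|x|^2}=\hat\mu\Big(\frac b2\Big)\qquad(*)$$ the geodesic $\gamma^b:=\gamma^{b,c}$ with $c=b\tan\frac b2\,x$ (that is, $c=\frac{b}{\sin b}(x-x\cos b)$ if $\sin b\neq0$). The square of its length is $$L(\gamma^b)^2=\frac{b^2}{\cos^2\frac b2}|x|^2=2bu-2|x|^2b\tan\frac b2,$$ and $L(\gamma^b)$ is strictly increasing with $b$ among the solutions of $(*)$.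 2. For each integer $m\ge1$ with $u\ge m\pi|x|^2$, the geodesics $\gamma^{b,c}$ with $b=2m\pi$ and any $c\in\mathbb{R}^n$ with $|c|=2\sqrt{m\pi u-(m\pi)^2|x|^2}$ (such $c$ exist). Their length is $L(\gamma^{b,c})=2\sqrt{m\pi u}$. There are only finitely many solutions $b$ of $(*)$ and finitely many such $m$, so that there are finitely many geodesics up to the choice of the direction of $c$ in 2; if $n=1$ or $u\le\pi|x|^2$, there are finitely many geodesics. Moreover, $(*)$ has a unique solution $b$ in the interval $(0,\pi)$. For this $b$, the geodesic $\gamma^b$ is strictly shorter than every other geodesic connecting $(x,0)$ and $(x,u)$, and $$d_{CC}((x,0),(x,u))=L(\gamma^b)=\frac{b}{\cos\frac b2}|x|=\sqrt{2bu-2|x|^2b\tan\frac b2}.$$ -/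

import Mathlib

open Set MeasureTheory
open scoped ENNReal

/-! Sub-Riemannian geometry of a finite family of vector fields on a normed space. -/

/-- `‖v‖_p² = inf { ∑ α_j² : v = ∑ α_j X_j(p) }`, with `inf ∅ = ∞`. -/
noncomputable def horizontalNormSq {ι M : Type*} [Fintype ι] [NormedAddCommGroup M]
    [NormedSpace ℝ M] (X : ι → M → M) (p v : M) : ℝ≥0∞ :=
  ⨅ (α : ι → ℝ) (_ : v = ∑ j, α j • X j p), ENNReal.ofReal (∑ j, α j ^ 2)

/-- Horizontal curves: absolutely continuous on `[0,1]`, with velocity in the span of the vector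
fields almost everywhere. Only the values of `γ` on `[0,1]` matter. -/
def IsHorizontalCurve {ι M : Type*} [NormedAddCommGroup M] [NormedSpace ℝ M]
    (X : ι → M → M) (γ : ℝ → M) : Prop :=
  AbsolutelyContinuousOnInterval γ 0 1 ∧
    ∀ᵐ t ∂(volume.restrict (Icc (0 : ℝ) 1)),
      deriv γ t ∈ Submodule.span ℝ (range fun j => X j (γ t))

/-- `L(γ) = ∫₀¹ ‖γ'(t)‖_{γ(t)} dt`. -/
noncomputable def curveLength {ι M : Type*} [Fintype ι] [NormedAddCommGroup M]
    [NormedSpace ℝ M] (X : ι → M → M) (γ : ℝ → M) : ℝ≥0∞ :=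
  ∫⁻ t in Icc (0 : ℝ) 1, horizontalNormSq X (γ t) (deriv γ t) ^ (1 / 2 : ℝ)

/-- The Carnot-Carathéodory distance associated with the vector fields. -/
noncomputable def ccDist {ι M : Type*} [Fintype ι] [NormedAddCommGroup M]
    [NormedSpace ℝ M] (X : ι → M → M) (p q : M) : ℝ≥0∞ :=
  ⨅ (γ : ℝ → M) (_ : IsHorizontalCurve X γ ∧ γ 0 = p ∧ γ 1 = q), curveLength X γ

/-! The Grushin vector fields `X_j = ∂_{x_j}` and `U_j = x_j ∂_u` on `ℝⁿ × ℝ`. -/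

noncomputable def grushinFields (n : ℕ) :
    Fin n ⊕ Fin n → EuclideanSpace ℝ (Fin n) × ℝ → EuclideanSpace ℝ (Fin n) × ℝ
  | Sum.inl j, _ => (EuclideanSpace.single j 1, 0)
  | Sum.inr j, p => (0, p.1 j)

/-- Length of a curve for the Grushin vector fields. -/
noncomputable def grushinLength {n : ℕ} (γ : ℝ → EuclideanSpace ℝ (Fin n) × ℝ) : ℝ≥0∞ :=
  curveLength (grushinFields n) γ

/-- Carnot-Carathéodory distance for the Grushin vector fields. -/
noncomputable def grushinDist {n : ℕ} (p q : EuclideanSpace ℝ (Fin n) × ℝ) : ℝ≥0∞ :=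
  ccDist (grushinFields n) p q

/-- Geodesics: the curves on `[0,1]` that solve the Euler-Lagrange equations
`γ₁'' + (γ₂'² / |γ₁|⁴) γ₁ = 0` and `d/dt (γ₂' / |γ₁|²) = 0` of the energy
`∫ (γ₂'² / |γ₁|² + |γ₁'|²) dt`. Here `v = γ₁'`, and `k` is the momentum `γ₂' / |γ₁|²`; the relation
`γ₂' = k |γ₁|²` is written without a quotient so that the equations make sense, in the usual
(Hamiltonian) way, also at the times when the curve meets `{x = 0}`. -/
def IsGrushinGeodesic {n : ℕ} (γ : ℝ → EuclideanSpace ℝ (Fin n) × ℝ) : Prop :=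
  ∃ (v : ℝ → EuclideanSpace ℝ (Fin n)) (k : ℝ → ℝ), ∀ t ∈ Icc (0 : ℝ) 1,
    HasDerivWithinAt (fun s => (γ s).1) (v t) (Icc 0 1) t ∧
    HasDerivWithinAt (fun s => (γ s).2) (k t * ‖(γ t).1‖ ^ 2) (Icc 0 1) t ∧
    HasDerivWithinAt v (-(k t ^ 2 • (γ t).1)) (Icc 0 1) t ∧
    HasDerivWithinAt k 0 (Icc 0 1) t

/-- `γ` is a geodesic connecting `p` and `q`. -/
def IsGeodesicFromTo {n : ℕ} (p q : EuclideanSpace ℝ (Fin n) × ℝ)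
    (γ : ℝ → EuclideanSpace ℝ (Fin n) × ℝ) : Prop :=
  IsGrushinGeodesic γ ∧ γ 0 = p ∧ γ 1 = q

/-- The explicit curve `γ^{b,c}` starting in `(x₁, u₁)`, with its limiting case `b = 0`. -/
noncomputable def grushinCurve {n : ℕ} (x₁ : EuclideanSpace ℝ (Fin n)) (u₁ b : ℝ)
    (c : EuclideanSpace ℝ (Fin n)) (t : ℝ) : EuclideanSpace ℝ (Fin n) × ℝ :=
  if b = 0 then (t • c + x₁, u₁)
  else
    ((Real.sin (b * t) / b) • c + Real.cos (b * t) • x₁,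
      ‖c‖ ^ 2 / b * (t / 2 - Real.sin (2 * b * t) / (4 * b))
        + inner ℝ x₁ c / b * Real.sin (b * t) ^ 2
        + ‖x₁‖ ^ 2 * b * (t / 2 + Real.sin (2 * b * t) / (4 * b)) + u₁)

/-- `μ̂(b) = b / cos² b + tan b`, for `cos b ≠ 0`. -/
noncomputable def muHat (b : ℝ) : ℝ := b / Real.cos b ^ 2 + Real.tan b

/-- `b` is a solution of `u / |x|² = μ̂(b / 2)`, with `b / 2` in the domain of `μ̂`. -/
def IsMuHatSolution {n : ℕ} (x : EuclideanSpace ℝ (Fin n)) (u b : ℝ) : Prop :=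
  Real.cos (b / 2) ≠ 0 ∧ u / ‖x‖ ^ 2 = muHat (b / 2)

/-- The curve `γ^b = γ^{b,c}` from `(x, 0)` with `c = b tan(b/2) x`, which is
`(b / sin b) (x - cos b • x)` when `sin b ≠ 0`, and its continuous extension when `sin b = 0` and
`cos (b / 2) ≠ 0`. -/
noncomputable def grushinCurveReturn {n : ℕ} (x : EuclideanSpace ℝ (Fin n)) (b : ℝ) :
    ℝ → EuclideanSpace ℝ (Fin n) × ℝ :=
  grushinCurve x 0 b ((b * Real.tan (b / 2)) • x)

/-!
A geodesic has constant momentum `b`, so its `ℝⁿ`-component solves `y'' = -b² y` and it is one of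
the explicit curves `γ^{b,c}` (`IsGeodesicFromTo.exists_eqOn_grushinCurve`). Returning to the
vertical line over `x` at time `1` means `sin (b / 2) (cos (b / 2) c - b sin (b / 2) x) = 0`: either
`b` is a multiple of `2π` and the height fixes only `|c|`, or `c = b tan (b / 2) x` and the height
gives the equation for `b`. In the form `b + sin b = h (1 + cos b)`, `h = u / |x|²`, this equation
has no poles, so finiteness of the solutions and uniqueness in `(0, π)` are read off an analytic
function.

By conservation of energy `γ^{b,c}` has speed `√(|c|² + b² |x|²)`. For a solution `b = 2φ` the
squared length is `4 |x|²` times the value at `φ` of `P(φ) = φ (h - tan φ)`, and the equation says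
that `φ` is a critical point of `P`, since `P' = h - μ̂`. Monotonicity of the length
(`sq_div_cos_sq_lt`) thus compares critical values of `P`. Between two consecutive poles, `μ̂` is
below `h` between the two solutions, so `P` increases from one to the other. For solutions
separated by a pole, the comparison follows from `φ (1 + tan² φ) = h - tan φ` and from the fact
that the solutions are at least `π` apart when `tan` is larger at the second one.

The distance is bounded from below by a calibration. With `w = -b tan (b (σ - 1/2))`, which solves
`w' = -(b² + w²)` and is smooth on `[0, 1]` exactly because `b < π`, the function
`b u + w(σ) |y|² / 2` grows along a horizontal curve of length `ℓ` by at most `ℓ² / 2` when `σ` is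
the proportion of length already covered (`calibration_sub_le`). Using this `σ` as an absolutely
continuous function of the parameter avoids reparametrizing the curve by arc length. The growth is
`b u - |x|² b tan (b / 2)`, half the squared length of `γ^b`.
-/

/-! ### The horizontal norm of the Grushin vector fields -/

theorem eq_sum_grushinFields_iff {n : ℕ} (p v : EuclideanSpace ℝ (Fin n) × ℝ)
    (α : Fin n ⊕ Fin n → ℝ) :
    v = ∑ j, α j • grushinFields n j p ↔
      (∀ j, v.1 j = α (Sum.inl j)) ∧ v.2 = ∑ j, α (Sum.inr j) * p.1 j := by
  have h1 : (∑ j, α j • grushinFields n j p).1 =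
      ∑ j, α (Sum.inl j) • EuclideanSpace.single j (1 : ℝ) := by
    simp [Fintype.sum_sum_type, grushinFields, Prod.fst_sum]
  have h2 : (∑ j, α j • grushinFields n j p).2 = ∑ j, α (Sum.inr j) * p.1 j := by
    simp [Fintype.sum_sum_type, grushinFields, Prod.snd_sum]
  have h3 : ∀ i, (∑ j, α (Sum.inl j) • EuclideanSpace.single j (1 : ℝ)) i = α (Sum.inl i) := by
    intro i
    simp [Pi.single_apply]
  rw [Prod.ext_iff, h1, h2]
  refine and_congr_left fun _ => ⟨fun h i => by rw [h, h3], fun h => ?_⟩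
  ext i
  rw [h, h3]

theorem ofReal_le_horizontalNormSq {n : ℕ} (p v : EuclideanSpace ℝ (Fin n) × ℝ) :
    ENNReal.ofReal (‖v.1‖ ^ 2 + (v.2 / ‖p.1‖) ^ 2) ≤
      horizontalNormSq (grushinFields n) p v := by
  refine le_iInf₂ fun α hα => ENNReal.ofReal_le_ofReal ?_
  obtain ⟨h1, h2⟩ := (eq_sum_grushinFields_iff p v α).1 hα
  have hcs := Finset.sum_mul_sq_le_sq_mul_sq Finset.univ (fun j => α (Sum.inr j)) (fun j => p.1 j)
  rw [← h2] at hcs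
  have hp : ‖p.1‖ ^ 2 = ∑ j, p.1 j ^ 2 := EuclideanSpace.real_norm_sq_eq _
  rw [Fintype.sum_sum_type, EuclideanSpace.real_norm_sq_eq]
  simp only [h1]
  gcongr
  rw [div_pow]
  apply div_le_of_le_mul₀ (by positivity) (Finset.sum_nonneg fun _ _ => sq_nonneg _)
  rw [hp]
  exact hcs

/-- Away from the characteristic set `{x = 0}`, or on it for vectors tangent to `ℝⁿ`, the
infimum is attained at the coefficients `(v₁, (v₂ / ‖x‖²) x)`. -/
theorem horizontalNormSq_grushinFields {n : ℕ} (p v : EuclideanSpace ℝ (Fin n) × ℝ)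
    (h : p.1 = 0 → v.2 = 0) :
    horizontalNormSq (grushinFields n) p v =
      ENNReal.ofReal (‖v.1‖ ^ 2 + (v.2 / ‖p.1‖) ^ 2) := by
  refine le_antisymm ?_ (ofReal_le_horizontalNormSq p v)
  have hp : ‖p.1‖ ^ 2 = ∑ j, p.1 j ^ 2 := EuclideanSpace.real_norm_sq_eq _
  let α : Fin n ⊕ Fin n → ℝ := Sum.elim (fun j => v.1 j) (fun j => v.2 / ‖p.1‖ ^ 2 * p.1 j)
  have hα : v = ∑ j, α j • grushinFields n j p := by
    rw [eq_sum_grushinFields_iff]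
    refine ⟨fun j => rfl, ?_⟩
    simp only [α, Sum.elim_inr, mul_assoc, ← Finset.mul_sum, ← sq, ← hp]
    by_cases h0 : p.1 = 0
    · simp [h0, h h0]
    · have : ‖p.1‖ ≠ 0 := norm_ne_zero_iff.2 h0
      field_simp
  refine (iInf₂_le α hα).trans (ENNReal.ofReal_le_ofReal (le_of_eq ?_))
  simp only [Fintype.sum_sum_type, α, Sum.elim_inl, Sum.elim_inr, mul_pow, ← Finset.mul_sum, ← hp,
    ← EuclideanSpace.real_norm_sq_eq]
  by_cases h0 : p.1 = 0
  · simp [h0]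
  · have : ‖p.1‖ ≠ 0 := norm_ne_zero_iff.2 h0
    field_simp

theorem snd_eq_zero_of_mem_span_grushinFields {n : ℕ} {p v : EuclideanSpace ℝ (Fin n) × ℝ}
    (hv : v ∈ Submodule.span ℝ (range fun j => grushinFields n j p)) (hp : p.1 = 0) :
    v.2 = 0 := by
  obtain ⟨α, hα⟩ := (Submodule.mem_span_range_iff_exists_fun ℝ).1 hv
  have := ((eq_sum_grushinFields_iff p v α).1 hα.symm).2
  simpa [hp] using this

theorem mem_span_grushinFields {n : ℕ} {p v : EuclideanSpace ℝ (Fin n) × ℝ}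
    (h : p.1 = 0 → v.2 = 0) :
    v ∈ Submodule.span ℝ (range fun j => grushinFields n j p) := by
  have hfin : horizontalNormSq (grushinFields n) p v ≠ ∞ := by
    rw [horizontalNormSq_grushinFields p v h]
    exact ENNReal.ofReal_ne_top
  by_contra hv
  refine hfin (iInf₂_eq_top.2 fun α hα => absurd ?_ hv)
  exact (Submodule.mem_span_range_iff_exists_fun ℝ).2 ⟨α, hα.symm⟩

/-! ### The explicit curves -/

/-- The `ℝⁿ`-component of the curve `γ^{b,c}` for `b ≠ 0`. -/
noncomputable def oscillatorPosition {n : ℕ} (x : EuclideanSpace ℝ (Fin n)) (b : ℝ)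
    (c : EuclideanSpace ℝ (Fin n)) (t : ℝ) : EuclideanSpace ℝ (Fin n) :=
  (Real.sin (b * t) / b) • c + Real.cos (b * t) • x

/-- The velocity of `oscillatorPosition x b c`. -/
noncomputable def oscillatorVelocity {n : ℕ} (x : EuclideanSpace ℝ (Fin n)) (b : ℝ)
    (c : EuclideanSpace ℝ (Fin n)) (t : ℝ) : EuclideanSpace ℝ (Fin n) :=
  Real.cos (b * t) • c - (b * Real.sin (b * t)) • x

section ExplicitCurves

variable {n : ℕ} (x c : EuclideanSpace ℝ (Fin n)) {b : ℝ}

theorem hasDerivAt_oscillatorPosition (hb : b ≠ 0) (t : ℝ) :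
    HasDerivAt (oscillatorPosition x b c) (oscillatorVelocity x b c t) t := by
  have hlin : HasDerivAt (fun t => b * t) b t := by simpa using (hasDerivAt_id t).const_mul b
  have h1 := ((hlin.sin.div_const b).smul_const c).add (hlin.cos.smul_const x)
  refine h1.congr_deriv ?_
  rw [oscillatorVelocity, mul_div_assoc, div_self hb, mul_one, sub_eq_add_neg, ← neg_smul]
  congr 2
  ring

theorem hasDerivAt_oscillatorVelocity (hb : b ≠ 0) (t : ℝ) :
    HasDerivAt (oscillatorVelocity x b c) (-(b ^ 2 • oscillatorPosition x b c t)) t := by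
  have hlin : HasDerivAt (fun t => b * t) b t := by simpa using (hasDerivAt_id t).const_mul b
  have h1 := (hlin.cos.smul_const c).sub ((hlin.sin.const_mul b).smul_const x)
  refine h1.congr_deriv ?_
  rw [oscillatorPosition, smul_add, smul_smul, smul_smul, neg_add, ← sub_eq_add_neg, ← neg_smul]
  congr 2
  · field_simp
  · ring

theorem norm_oscillatorPosition_sq (t : ℝ) :
    ‖oscillatorPosition x b c t‖ ^ 2 = (Real.sin (b * t) / b) ^ 2 * ‖c‖ ^ 2 +
      2 * (Real.sin (b * t) / b) * Real.cos (b * t) * inner ℝ x c +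
      Real.cos (b * t) ^ 2 * ‖x‖ ^ 2 := by
  rw [oscillatorPosition, norm_add_sq_real, norm_smul, norm_smul, mul_pow, mul_pow, Real.norm_eq_abs,
    Real.norm_eq_abs, sq_abs, sq_abs, real_inner_smul_left, real_inner_smul_right,
    real_inner_comm x c]
  ring

theorem norm_oscillatorVelocity_sq (t : ℝ) :
    ‖oscillatorVelocity x b c t‖ ^ 2 = Real.cos (b * t) ^ 2 * ‖c‖ ^ 2 -
      2 * b * Real.sin (b * t) * Real.cos (b * t) * inner ℝ x c +
      (b * Real.sin (b * t)) ^ 2 * ‖x‖ ^ 2 := by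
  rw [oscillatorVelocity, norm_sub_sq_real, norm_smul, norm_smul, mul_pow, mul_pow,
    Real.norm_eq_abs, Real.norm_eq_abs, sq_abs, sq_abs, real_inner_smul_left,
    real_inner_smul_right, real_inner_comm x c]
  ring

/-- Conservation of energy along the harmonic oscillator: the explicit curves have constant
speed. -/
theorem oscillator_energy (hb : b ≠ 0) (t : ℝ) :
    ‖oscillatorVelocity x b c t‖ ^ 2 + b ^ 2 * ‖oscillatorPosition x b c t‖ ^ 2 =
      ‖c‖ ^ 2 + b ^ 2 * ‖x‖ ^ 2 := by
  rw [norm_oscillatorPosition_sq, norm_oscillatorVelocity_sq]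
  have := Real.sin_sq_add_cos_sq (b * t)
  field_simp
  linear_combination (‖c‖ ^ 2 + b ^ 2 * ‖x‖ ^ 2) * this

theorem grushinCurve_fst (hb : b ≠ 0) (t : ℝ) :
    (grushinCurve x 0 b c t).1 = oscillatorPosition x b c t := by
  simp [grushinCurve, hb, oscillatorPosition]

theorem hasDerivAt_grushinCurve_snd (hb : b ≠ 0) (t : ℝ) :
    HasDerivAt (fun s => (grushinCurve x 0 b c s).2) (b * ‖oscillatorPosition x b c t‖ ^ 2) t := by
  have hlin : HasDerivAt (fun t => b * t) b t := by simpa using (hasDerivAt_id t).const_mul b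
  have hlin2 : HasDerivAt (fun t => 2 * b * t) (2 * b) t := by
    simpa using (hasDerivAt_id t).const_mul (2 * b)
  have hhalf : HasDerivAt (fun t : ℝ => t / 2) (1 / 2) t := (hasDerivAt_id t).div_const 2
  have h1 := ((((hhalf.sub (hlin2.sin.div_const (4 * b))).const_mul (‖c‖ ^ 2 / b)).add
    ((hlin.sin.pow 2).const_mul (inner ℝ x c / b))).add
    ((hhalf.add (hlin2.sin.div_const (4 * b))).const_mul (‖x‖ ^ 2 * b))).add_const (0 : ℝ)
  have hfun : (fun s => (grushinCurve x 0 b c s).2) = fun t =>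
      ‖c‖ ^ 2 / b * (t / 2 - Real.sin (2 * b * t) / (4 * b))
        + inner ℝ x c / b * Real.sin (b * t) ^ 2
        + ‖x‖ ^ 2 * b * (t / 2 + Real.sin (2 * b * t) / (4 * b)) + 0 := by
    funext s
    simp [grushinCurve, hb]
  rw [hfun]
  refine h1.congr_deriv ?_
  have hcos : Real.cos (2 * b * t) = 2 * Real.cos (b * t) ^ 2 - 1 := by
    rw [mul_assoc, Real.cos_two_mul]
  have hsin := Real.sin_sq (b * t)
  rw [norm_oscillatorPosition_sq, hcos]
  field_simp
  simp only [Nat.cast_ofNat, Nat.reduceSub, pow_one]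
  linear_combination (-8 * ‖c‖ ^ 2) * hsin

theorem hasDerivAt_grushinCurve (hb : b ≠ 0) (t : ℝ) :
    HasDerivAt (grushinCurve x 0 b c)
      (oscillatorVelocity x b c t, b * ‖oscillatorPosition x b c t‖ ^ 2) t := by
  have h1 : HasDerivAt (fun s => (grushinCurve x 0 b c s).1) (oscillatorVelocity x b c t) t := by
    simp only [grushinCurve_fst x c hb]
    exact hasDerivAt_oscillatorPosition x c hb t
  exact h1.prodMk (hasDerivAt_grushinCurve_snd x c hb t)

theorem grushinCurve_zero (hb : b ≠ 0) : grushinCurve x 0 b c 0 = (x, 0) := by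
  simp [grushinCurve, hb]

theorem isGrushinGeodesic_grushinCurve (hb : b ≠ 0) :
    IsGrushinGeodesic (grushinCurve x 0 b c) := by
  refine ⟨oscillatorVelocity x b c, fun _ => b, fun t _ => ⟨?_, ?_, ?_, ?_⟩⟩
  · simp only [grushinCurve_fst x c hb]
    exact (hasDerivAt_oscillatorPosition x c hb t).hasDerivWithinAt
  · rw [grushinCurve_fst x c hb]
    exact (hasDerivAt_grushinCurve_snd x c hb t).hasDerivWithinAt
  · rw [grushinCurve_fst x c hb]
    exact (hasDerivAt_oscillatorVelocity x c hb t).hasDerivWithinAt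
  · exact hasDerivWithinAt_const _ _ _

theorem horizontalNormSq_deriv_grushinCurve (hb : b ≠ 0) (t : ℝ) :
    horizontalNormSq (grushinFields n) (grushinCurve x 0 b c t) (deriv (grushinCurve x 0 b c) t) =
      ENNReal.ofReal (‖c‖ ^ 2 + b ^ 2 * ‖x‖ ^ 2) := by
  rw [(hasDerivAt_grushinCurve x c hb t).deriv, horizontalNormSq_grushinFields,
    grushinCurve_fst x c hb, ← oscillator_energy x c hb t]
  · congr 2
    by_cases h0 : ‖oscillatorPosition x b c t‖ = 0
    · simp [h0]
    · field_simp
  · intro h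
    rw [grushinCurve_fst x c hb] at h
    simp [h]

theorem grushinLength_grushinCurve (hb : b ≠ 0) :
    grushinLength (grushinCurve x 0 b c) = ENNReal.ofReal (√(‖c‖ ^ 2 + b ^ 2 * ‖x‖ ^ 2)) := by
  simp only [grushinLength, curveLength, horizontalNormSq_deriv_grushinCurve x c hb]
  rw [ENNReal.ofReal_rpow_of_nonneg (by positivity) (by norm_num), ← Real.sqrt_eq_rpow]
  simp

theorem isHorizontalCurve_grushinCurve (hb : b ≠ 0) :
    IsHorizontalCurve (grushinFields n) (grushinCurve x 0 b c) := by
  constructor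
  · apply ContDiffOn.absolutelyContinuousOnInterval
    have : grushinCurve x 0 b c = fun t => ((Real.sin (b * t) / b) • c + Real.cos (b * t) • x,
      ‖c‖ ^ 2 / b * (t / 2 - Real.sin (2 * b * t) / (4 * b))
        + inner ℝ x c / b * Real.sin (b * t) ^ 2
        + ‖x‖ ^ 2 * b * (t / 2 + Real.sin (2 * b * t) / (4 * b)) + 0) := by
      funext t
      simp [grushinCurve, hb]
    rw [this]
    apply ContDiff.contDiffOn
    fun_prop
  · refine Filter.Eventually.of_forall fun t => mem_span_grushinFields fun h => ?_
    rw [grushinCurve_fst x c hb] at h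
    rw [(hasDerivAt_grushinCurve x c hb t).deriv]
    simp [h]

end ExplicitCurves

/-! ### Integration of the geodesic equations -/

theorem eq_of_hasDerivWithinAt_zero {E : Type*} [NormedAddCommGroup E] [NormedSpace ℝ E]
    {f : ℝ → E} (hf : ∀ t ∈ Icc (0 : ℝ) 1, HasDerivWithinAt f 0 (Icc 0 1) t) :
    ∀ t ∈ Icc (0 : ℝ) 1, f t = f 0 := by
  refine constant_of_has_deriv_right_zero (fun t ht => (hf t ht).continuousWithinAt) fun t ht => ?_
  exact (hf t ⟨ht.1, ht.2.le⟩).mono_of_mem_nhdsWithin (Icc_mem_nhdsGE_of_mem ht)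

/-- Solutions of the harmonic oscillator equation are determined by their initial data, because
the energy of a difference of two solutions is conserved. -/
theorem eqOn_oscillatorPosition {n : ℕ} {b : ℝ} (hb : b ≠ 0) {y v : ℝ → EuclideanSpace ℝ (Fin n)}
    (hy : ∀ t ∈ Icc (0 : ℝ) 1, HasDerivWithinAt y (v t) (Icc 0 1) t)
    (hv : ∀ t ∈ Icc (0 : ℝ) 1, HasDerivWithinAt v (-(b ^ 2 • y t)) (Icc 0 1) t) :
    EqOn y (oscillatorPosition (y 0) b (v 0)) (Icc 0 1) := by
  let d := fun t => y t - oscillatorPosition (y 0) b (v 0) t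
  let e := fun t => v t - oscillatorVelocity (y 0) b (v 0) t
  have hE := eq_of_hasDerivWithinAt_zero (f := fun t => ‖e t‖ ^ 2 + b ^ 2 * ‖d t‖ ^ 2) ?_
  · intro t ht
    have h0 := hE t ht
    have hd0 : d 0 = 0 := by simp [d, oscillatorPosition]
    have he0 : e 0 = 0 := by simp [e, oscillatorVelocity]
    simp only [hd0, he0] at h0
    have hd : ‖d t‖ ^ 2 = 0 := by
      have h1 : 0 ≤ ‖e t‖ ^ 2 := sq_nonneg _
      have h2 : 0 ≤ b ^ 2 * ‖d t‖ ^ 2 := by positivity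
      have h3 : b ^ 2 * ‖d t‖ ^ 2 = 0 := by
        refine le_antisymm ?_ h2
        simp at h0
        linarith
      simpa [hb] using h3
    exact sub_eq_zero.1 (by simpa using hd)
  · intro t ht
    have hd : HasDerivWithinAt d (e t) (Icc 0 1) t :=
      (hy t ht).sub (hasDerivAt_oscillatorPosition (y 0) (v 0) hb t).hasDerivWithinAt
    have he : HasDerivWithinAt e (-(b ^ 2 • d t)) (Icc 0 1) t := by
      refine ((hv t ht).sub
        (hasDerivAt_oscillatorVelocity (y 0) (v 0) hb t).hasDerivWithinAt).congr_deriv ?_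
      simp only [d, smul_sub]
      abel
    refine (he.norm_sq.add (hd.norm_sq.const_mul (b ^ 2))).congr_deriv ?_
    rw [inner_neg_right, real_inner_smul_right, real_inner_comm (d t)]
    ring

/-- A geodesic from `(x, 0)` whose endpoints have different heights is one of the explicit
curves. -/
theorem IsGeodesicFromTo.exists_eqOn_grushinCurve {n : ℕ} {x y : EuclideanSpace ℝ (Fin n)} {u : ℝ}
    (hu : u ≠ 0) {γ : ℝ → EuclideanSpace ℝ (Fin n) × ℝ} (h : IsGeodesicFromTo (x, 0) (y, u) γ) :
    ∃ b ≠ 0, ∃ c, EqOn γ (grushinCurve x 0 b c) (Icc 0 1) := by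
  obtain ⟨⟨v, k, hγ⟩, h0, h1⟩ := h
  have hk := eq_of_hasDerivWithinAt_zero fun t ht => (hγ t ht).2.2.2
  have hone : (1 : ℝ) ∈ Icc (0 : ℝ) 1 := by simp
  have hb : k 0 ≠ 0 := by
    intro hk0
    have := eq_of_hasDerivWithinAt_zero (f := fun t => (γ t).2) (fun t ht => by
      simpa [hk t ht, hk0] using (hγ t ht).2.1) 1 hone
    simp [h0, h1] at this
    exact hu this
  have hfst := eqOn_oscillatorPosition hb (fun t ht => (hγ t ht).1) (fun t ht => by
    simpa [hk t ht] using (hγ t ht).2.2.1)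
  simp only [h0] at hfst
  refine ⟨k 0, hb, v 0, fun t ht => Prod.ext ?_ ?_⟩
  · rw [grushinCurve_fst x (v 0) hb]
    exact hfst ht
  · have hsnd := eq_of_hasDerivWithinAt_zero
      (f := fun t => (γ t).2 - (grushinCurve x 0 (k 0) (v 0) t).2) (fun t ht => by
        refine ((hγ t ht).2.1.sub
          (hasDerivAt_grushinCurve_snd x (v 0) hb t).hasDerivWithinAt).congr_deriv ?_
        rw [hk t ht, show (γ t).1 = _ from hfst ht, sub_self]) t ht
    simpa [h0, grushinCurve_zero x (v 0) hb, sub_eq_zero] using hsnd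

theorem grushinLength_congr {n : ℕ} {γ δ : ℝ → EuclideanSpace ℝ (Fin n) × ℝ}
    (h : EqOn γ δ (Icc 0 1)) : grushinLength γ = grushinLength δ := by
  rw [grushinLength, grushinLength, curveLength, curveLength, ← restrict_Ioo_eq_restrict_Icc]
  refine setLIntegral_congr_fun measurableSet_Ioo fun t ht => ?_
  have hev : γ =ᶠ[nhds t] δ := h.eventuallyEq_of_mem (Icc_mem_nhds ht.1 ht.2)
  simp only [hev.deriv_eq, hev.eq_of_nhds]

theorem IsGeodesicFromTo.congr {n : ℕ} {p q : EuclideanSpace ℝ (Fin n) × ℝ}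
    {γ δ : ℝ → EuclideanSpace ℝ (Fin n) × ℝ} (hδ : IsGeodesicFromTo p q δ)
    (h : EqOn γ δ (Icc 0 1)) : IsGeodesicFromTo p q γ := by
  obtain ⟨⟨v, k, hv⟩, h0, h1⟩ := hδ
  refine ⟨⟨v, k, fun t ht => ?_⟩, by rw [h (by simp), h0], by rw [h (by simp), h1]⟩
  rw [h ht]
  refine ⟨(hv t ht).1.congr (fun s hs => ?_) ?_, (hv t ht).2.1.congr (fun s hs => ?_) ?_,
    (hv t ht).2.2⟩
  · rw [h hs]
  · rw [h ht]
  · rw [h hs]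
  · rw [h ht]

/-! ### The equation for the frequency -/

section Frequency

/-- The equation `h = μ̂(b / 2)` without quotients. The side condition `cos (b / 2) ≠ 0` is
automatic: where it fails, the right-hand side vanishes and the left-hand side is `b ≠ 0`. -/
theorem isMuHatSolution_iff {n : ℕ} (x : EuclideanSpace ℝ (Fin n)) (u b : ℝ) :
    IsMuHatSolution x u b ↔ b + Real.sin b = u / ‖x‖ ^ 2 * (1 + Real.cos b) := by
  obtain ⟨φ, rfl⟩ : ∃ φ, b = 2 * φ := ⟨b / 2, by ring⟩
  rw [IsMuHatSolution, muHat, mul_div_cancel_left₀ φ two_ne_zero, Real.sin_two_mul,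
    Real.cos_two_mul, Real.tan_eq_sin_div_cos]
  constructor
  · rintro ⟨hc, h⟩
    rw [h]
    field_simp
    ring
  · intro h
    have hc : Real.cos φ ≠ 0 := by
      intro hc
      rw [hc] at h
      have h0 : φ = 0 := by linarith
      simp [h0] at hc
    refine ⟨hc, ?_⟩
    field_simp
    linear_combination (-1 / 2) * h

variable {h : ℝ}

theorem pos_of_add_sin_eq (hh : 0 < h) {b : ℝ} (hb : b + Real.sin b = h * (1 + Real.cos b)) :
    0 < b := by
  by_contra! hle
  have h1 : 0 ≤ h * (1 + Real.cos b) := by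
    have := Real.neg_one_le_cos b
    exact mul_nonneg hh.le (by linarith)
  rcases hle.lt_or_eq with hlt | rfl
  · have h2 := Real.abs_sin_lt_abs hlt.ne
    have h3 := le_abs_self (Real.sin b)
    rw [abs_of_neg hlt] at h2
    linarith
  · norm_num at hb
    linarith

theorem finite_setOf_add_sin_eq (hh : 0 < h) :
    {b : ℝ | b + Real.sin b = h * (1 + Real.cos b)}.Finite := by
  let f : ℝ → ℝ := fun b => b + Real.sin b - h * (1 + Real.cos b)
  have hf : AnalyticOnNhd ℝ f (Icc 0 (1 + 2 * h)) := fun b _ => by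
    have := Real.analyticAt_sin (x := b)
    have := Real.analyticAt_cos (x := b)
    fun_prop
  have h0 : (0 : ℝ) ∈ Icc 0 (1 + 2 * h) := ⟨le_rfl, by linarith⟩
  have hf0 : f 0 ≠ 0 := by
    simp [f]
    exact hh.ne'
  refine (isCompact_Icc.finite_sdiff_of_mem_codiscreteWithin
    (hf.preimage_zero_mem_codiscreteWithin hf0 h0 (isConnected_Icc h0.2))).subset fun b hb => ?_
  refine ⟨⟨(pos_of_add_sin_eq hh hb).le, ?_⟩, ?_⟩
  · have h1 := Real.neg_one_le_sin b
    have h2 : h * (1 + Real.cos b) ≤ h * 2 :=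
      mul_le_mul_of_nonneg_left (by linarith [Real.cos_le_one b]) hh.le
    have h3 : b + Real.sin b = h * (1 + Real.cos b) := hb
    linarith
  · have h3 : b + Real.sin b = h * (1 + Real.cos b) := hb
    simp [f, h3]

theorem existsUnique_add_sin_eq (hh : 0 < h) :
    ∃! b : ℝ, b ∈ Ioo 0 Real.pi ∧ b + Real.sin b = h * (1 + Real.cos b) := by
  let f : ℝ → ℝ := fun b => b + Real.sin b - h * (1 + Real.cos b)
  have hcont : Continuous f := by fun_prop
  have hmono : StrictMonoOn f (Icc 0 Real.pi) := by
    refine strictMonoOn_of_deriv_pos (convex_Icc _ _) hcont.continuousOn fun b hb => ?_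
    rw [interior_Icc] at hb
    have hd : HasDerivAt f (1 + Real.cos b - h * -Real.sin b) b :=
      ((hasDerivAt_id b).add (Real.hasDerivAt_sin b)).sub
        (((Real.hasDerivAt_cos b).const_add 1).const_mul h)
    rw [hd.deriv]
    have h1 := mul_pos hh (Real.sin_pos_of_mem_Ioo hb)
    have h2 := Real.neg_one_le_cos b
    linarith
  obtain ⟨b, hb, hfb⟩ := intermediate_value_Ioo Real.pi_pos.le hcont.continuousOn
    (show (0 : ℝ) ∈ Ioo (f 0) (f Real.pi) by
      constructor
      · simp [f]
        exact hh
      · simp [f, Real.pi_pos])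
  refine ⟨b, ⟨hb, sub_eq_zero.1 hfb⟩, fun b' hb' => ?_⟩
  refine hmono.injOn (Ioo_subset_Icc_self hb'.1) (Ioo_subset_Icc_self hb) ?_
  rw [hfb]
  exact sub_eq_zero.2 hb'.2

end Frequency

/-! ### Monotonicity of the length -/

section Monotonicity

variable {h φ₁ φ₂ : ℝ}

theorem hasDerivAt_muHat {φ : ℝ} (hc : Real.cos φ ≠ 0) :
    HasDerivAt muHat (2 * (Real.cos φ + φ * Real.sin φ) / Real.cos φ ^ 3) φ := by
  have h1 := ((hasDerivAt_id φ).div ((Real.hasDerivAt_cos φ).pow 2) (pow_ne_zero 2 hc)).add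
    (Real.hasDerivAt_tan hc)
  refine h1.congr_deriv ?_
  simp only [id, Pi.pow_apply, Nat.cast_ofNat, Nat.reduceSub, pow_one]
  field_simp
  ring

/-- The primitive of `h - μ̂` whose critical values are the squared lengths. -/
theorem hasDerivAt_criticalFunction {φ : ℝ} (hc : Real.cos φ ≠ 0) :
    HasDerivAt (fun φ => φ * (h - Real.tan φ)) (h - muHat φ) φ := by
  refine ((hasDerivAt_id φ).mul ((Real.hasDerivAt_tan hc).const_sub h)).congr_deriv ?_
  simp only [id, muHat]
  ring

theorem mul_sub_tan_eq {φ : ℝ} (hφ : muHat φ = h) :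
    φ * (h - Real.tan φ) = φ ^ 2 / Real.cos φ ^ 2 := by
  rw [← hφ, muHat]
  ring

/-- For `φ > 0` the function `μ̂` cannot first increase and then decrease while `cos φ` keeps
the sign `σ`, so it stays below the level `h` between two points of that level. -/
theorem muHat_lt_of_mem_Ioo {σ : ℝ} (h₁ : 0 < φ₁)
    (hσ : ∀ φ ∈ Icc φ₁ φ₂, 0 < σ * Real.cos φ) (e₁ : muHat φ₁ = h) (e₂ : muHat φ₂ = h)
    {ψ : ℝ} (hψ : ψ ∈ Ioo φ₁ φ₂) : muHat ψ < h := by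
  have hc : ∀ φ ∈ Icc φ₁ φ₂, Real.cos φ ≠ 0 := fun φ hφ h0 => by simpa [h0] using hσ φ hφ
  have hsub₁ : Icc φ₁ ψ ⊆ Icc φ₁ φ₂ := Icc_subset_Icc le_rfl hψ.2.le
  have hsub₂ : Icc ψ φ₂ ⊆ Icc φ₁ φ₂ := Icc_subset_Icc hψ.1.le le_rfl
  have hcont : ContinuousOn muHat (Icc φ₁ φ₂) := fun φ hφ =>
    (hasDerivAt_muHat (hc φ hφ)).continuousAt.continuousWithinAt
  -- the derivative of `μ̂` has the sign of the increasing function `q`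
  let q : ℝ → ℝ := fun φ => σ * (Real.cos φ + φ * Real.sin φ)
  have hq : StrictMonoOn q (Icc φ₁ φ₂) := by
    refine strictMonoOn_of_deriv_pos (convex_Icc _ _) (by fun_prop) fun φ hφ => ?_
    rw [interior_Icc] at hφ
    have hd : HasDerivAt q (σ * (-Real.sin φ + (1 * Real.sin φ + φ * Real.cos φ))) φ :=
      ((Real.hasDerivAt_cos φ).add ((hasDerivAt_id φ).mul (Real.hasDerivAt_sin φ))).const_mul σ
    rw [hd.deriv]
    have := mul_pos (h₁.trans hφ.1) (hσ φ (Ioo_subset_Icc_self hφ))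
    linarith
  have key : ∀ φ ∈ Icc φ₁ φ₂, 2 * (Real.cos φ + φ * Real.sin φ) / Real.cos φ ^ 3 =
      q φ * (2 * (σ * Real.cos φ) / (σ * Real.cos φ ^ 2) ^ 2) := by
    intro φ hφ
    have h1 := hc φ hφ
    have h2 : σ ≠ 0 := fun h0 => by simpa [h0] using hσ φ hφ
    simp only [q]
    field_simp
  have hpos : ∀ φ ∈ Icc φ₁ φ₂, 0 < 2 * (σ * Real.cos φ) / (σ * Real.cos φ ^ 2) ^ 2 := by
    intro φ hφ
    have h1 := hc φ hφ
    have h2 : σ ≠ 0 := fun h0 => by simpa [h0] using hσ φ hφ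
    have := hσ φ hφ
    positivity
  by_contra! hge
  obtain ⟨ξ₁, hξ₁, hs₁⟩ := exists_hasDerivAt_eq_slope muHat _ hψ.1 (hcont.mono hsub₁)
    fun φ hφ => hasDerivAt_muHat (hc φ (hsub₁ (Ioo_subset_Icc_self hφ)))
  obtain ⟨ξ₂, hξ₂, hs₂⟩ := exists_hasDerivAt_eq_slope muHat _ hψ.2 (hcont.mono hsub₂)
    fun φ hφ => hasDerivAt_muHat (hc φ (hsub₂ (Ioo_subset_Icc_self hφ)))
  have hm₁ := hsub₁ (Ioo_subset_Icc_self hξ₁)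
  have hm₂ := hsub₂ (Ioo_subset_Icc_self hξ₂)
  have hq₁ : 0 ≤ q ξ₁ := by
    have : 0 ≤ (muHat ψ - muHat φ₁) / (ψ - φ₁) :=
      div_nonneg (by linarith) (sub_pos.2 hψ.1).le
    rw [← hs₁, key ξ₁ hm₁] at this
    exact nonneg_of_mul_nonneg_left this (hpos ξ₁ hm₁)
  have hq₂ : q ξ₂ ≤ 0 := by
    have : (muHat φ₂ - muHat ψ) / (φ₂ - ψ) ≤ 0 :=
      div_nonpos_of_nonpos_of_nonneg (by linarith) (sub_pos.2 hψ.2).le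
    rw [← hs₂, key ξ₂ hm₂] at this
    exact nonpos_of_mul_nonpos_left this (hpos ξ₂ hm₂)
  have := hq hm₁ hm₂ (hξ₁.2.trans hξ₂.1)
  linarith

theorem mul_sub_tan_lt_of_cos_ne_zero {σ : ℝ} (h₁ : 0 < φ₁) (h₁₂ : φ₁ < φ₂)
    (hσ : ∀ φ ∈ Icc φ₁ φ₂, 0 < σ * Real.cos φ) (e₁ : muHat φ₁ = h) (e₂ : muHat φ₂ = h) :
    φ₁ * (h - Real.tan φ₁) < φ₂ * (h - Real.tan φ₂) := by
  have hc : ∀ φ ∈ Icc φ₁ φ₂, Real.cos φ ≠ 0 := fun φ hφ h0 => by simpa [h0] using hσ φ hφ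
  have hmono : StrictMonoOn (fun φ => φ * (h - Real.tan φ)) (Icc φ₁ φ₂) := by
    refine strictMonoOn_of_deriv_pos (convex_Icc _ _) (fun φ hφ =>
      (hasDerivAt_criticalFunction (hc φ hφ)).continuousAt.continuousWithinAt) fun φ hφ => ?_
    rw [interior_Icc] at hφ
    rw [(hasDerivAt_criticalFunction (hc φ (Ioo_subset_Icc_self hφ))).deriv]
    exact sub_pos.2 (muHat_lt_of_mem_Ioo h₁ hσ e₁ e₂ hφ)
  exact hmono (left_mem_Icc.2 h₁₂.le) (right_mem_Icc.2 h₁₂.le) h₁₂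

theorem mul_sub_tan_lt_of_pi_le (h₁ : 0 < φ₁) (h₁₂ : φ₁ + Real.pi ≤ φ₂)
    (hlt : Real.tan φ₁ < Real.tan φ₂)
    (e₁ : φ₁ * (1 + Real.tan φ₁ ^ 2) = h - Real.tan φ₁)
    (e₂ : φ₂ * (1 + Real.tan φ₂ ^ 2) = h - Real.tan φ₂) :
    φ₁ * (h - Real.tan φ₁) < φ₂ * (h - Real.tan φ₂) := by
  have hpi := Real.pi_gt_three
  have hlt' : φ₁ < φ₂ := by linarith
  by_cases habs : |Real.tan φ₁| ≤ |Real.tan φ₂|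
  · rw [← e₁, ← e₂]
    have := sq_le_sq.2 habs
    have h2 : 0 < φ₂ := h₁.trans hlt'
    exact mul_lt_mul hlt' (mul_le_mul hlt'.le (by linarith) (by positivity) h2.le)
      (by positivity) h2.le
  · push Not at habs
    have hneg : Real.tan φ₁ < 0 := by
      by_contra! h0
      rw [abs_of_nonneg h0, abs_of_nonneg (h0.trans hlt.le)] at habs
      linarith
    have hhalf : Real.pi / 2 < φ₁ := by
      by_contra! h0
      exact absurd (Real.tan_nonneg_of_nonneg_of_le_pi_div_two h₁.le h0) (by linarith)
    generalize Real.tan φ₁ = T₁ at *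
    generalize Real.tan φ₂ = T₂ at *
    rw [abs_of_neg hneg] at habs
    have hT₂ : T₂ < -T₁ := (le_abs_self _).trans_lt habs
    have hpos : 0 < h - T₂ := by
      rw [← e₂]
      exact mul_pos (by linarith) (by positivity)
    have s1 : Real.pi * (h - T₂) ≤ (φ₂ - φ₁) * (h - T₂) := by
      apply mul_le_mul_of_nonneg_right _ hpos.le
      linarith
    have s2 : φ₁ * (T₂ - T₁) ≤ φ₁ * (-2 * T₁) :=
      mul_le_mul_of_nonneg_left (by linarith) h₁.le
    have s3 : Real.pi * (φ₁ * (1 + T₁ ^ 2) + 2 * T₁) < Real.pi * (h - T₂) :=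
      mul_lt_mul_of_pos_left (by linarith) (by linarith)
    -- `2 |T₁| ≤ 1 + T₁²` and `3 < π`
    have s4 : -6 * T₁ ≤ Real.pi * (1 + T₁ ^ 2) := by nlinarith [sq_nonneg (T₁ + 1)]
    have s5 : 0 ≤ (φ₁ - Real.pi / 2) * (Real.pi * (1 + T₁ ^ 2) + 2 * T₁) :=
      mul_nonneg (by linarith) (by linarith)
    have s6 : 0 ≤ Real.pi / 2 * (Real.pi * (1 + T₁ ^ 2) + 6 * T₁) :=
      mul_nonneg (by linarith) (by linarith)
    linarith

/-- The critical values of `φ ↦ φ (h - tan φ)` increase with the critical point `φ > 0`. Between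
two poles of `tan` this is because the function increases between its two critical points; if the
critical points are separated by a pole, either `tan φ₂ ≤ tan φ₁`, and both factors compare, or
`φ₁ + π ≤ φ₂`. -/
theorem sq_div_cos_sq_lt (h₁ : 0 < φ₁) (h₁₂ : φ₁ < φ₂) (c₁ : Real.cos φ₁ ≠ 0)
    (c₂ : Real.cos φ₂ ≠ 0) (e₁ : muHat φ₁ = h) (e₂ : muHat φ₂ = h) :
    φ₁ ^ 2 / Real.cos φ₁ ^ 2 < φ₂ ^ 2 / Real.cos φ₂ ^ 2 := by
  have e₁' : φ₁ * (1 + Real.tan φ₁ ^ 2) = h - Real.tan φ₁ := by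
    rw [← e₁, muHat, add_sub_cancel_right, ← Real.inv_one_add_tan_sq c₁, div_inv_eq_mul]
  have e₂' : φ₂ * (1 + Real.tan φ₂ ^ 2) = h - Real.tan φ₂ := by
    rw [← e₂, muHat, add_sub_cancel_right, ← Real.inv_one_add_tan_sq c₂, div_inv_eq_mul]
  rw [← mul_sub_tan_eq e₁, ← mul_sub_tan_eq e₂]
  rcases le_or_gt (Real.tan φ₂) (Real.tan φ₁) with hle | hlt
  · have hpos : 0 < h - Real.tan φ₁ := by
      rw [← e₁']
      positivity
    exact mul_lt_mul h₁₂ (by linarith) hpos (h₁.trans h₁₂).le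
  rcases le_or_gt Real.pi (φ₂ - φ₁) with hpi | hpi
  · exact mul_sub_tan_lt_of_pi_le h₁ (by linarith) hlt e₁' e₂'
  have hsin : 0 < Real.sin (φ₂ - φ₁) := Real.sin_pos_of_pos_of_lt_pi (by linarith) hpi
  have htan : Real.sin (φ₂ - φ₁) =
      (Real.tan φ₂ - Real.tan φ₁) * (Real.cos φ₁ * Real.cos φ₂) := by
    rw [Real.sin_sub, Real.tan_eq_sin_div_cos, Real.tan_eq_sin_div_cos]
    field_simp
  have hcc : 0 < Real.cos φ₁ * Real.cos φ₂ := by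
    rw [htan] at hsin
    exact pos_of_mul_pos_right hsin (by linarith)
  refine mul_sub_tan_lt_of_cos_ne_zero (σ := Real.cos φ₁) h₁ h₁₂ (fun φ hφ => ?_) e₁ e₂
  -- `cos φ` is a combination of `cos φ₁` and `cos φ₂` with nonnegative coefficients
  have hcomb : Real.cos φ₁ * Real.cos φ * Real.sin (φ₂ - φ₁) =
      Real.cos φ₁ ^ 2 * Real.sin (φ₂ - φ) +
        Real.cos φ₁ * Real.cos φ₂ * Real.sin (φ - φ₁) := by
    simp only [Real.sin_sub]
    ring
  refine pos_of_mul_pos_left (b := Real.sin (φ₂ - φ₁)) ?_ hsin.le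
  rw [hcomb]
  have k1 : 0 ≤ Real.sin (φ₂ - φ) :=
    Real.sin_nonneg_of_nonneg_of_le_pi (by linarith [hφ.2]) (by linarith [hφ.1])
  have k2 : 0 ≤ Real.sin (φ - φ₁) :=
    Real.sin_nonneg_of_nonneg_of_le_pi (by linarith [hφ.1]) (by linarith [hφ.2])
  rcases hφ.1.eq_or_lt with rfl | hlt
  · have := mul_pos (sq_pos_of_ne_zero c₁) hsin
    linarith [mul_nonneg hcc.le k2]
  · have := mul_pos hcc (Real.sin_pos_of_pos_of_lt_pi (sub_pos.2 hlt) (by linarith [hφ.2]))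
    linarith [mul_nonneg (sq_nonneg (Real.cos φ₁)) k1]

end Monotonicity

/-! ### Absolutely continuous curves -/

theorem LipschitzOnWith.comp_absolutelyContinuousOnInterval {X Y : Type*} [PseudoMetricSpace X]
    [PseudoMetricSpace Y] {g : X → Y} {f : ℝ → X} {K : NNReal} {s : Set X} {a b : ℝ}
    (hg : LipschitzOnWith K g s) (hf : AbsolutelyContinuousOnInterval f a b)
    (hs : MapsTo f (uIcc a b) s) : AbsolutelyContinuousOnInterval (fun t => g (f t)) a b := by
  rw [absolutelyContinuousOnInterval_iff] at hf ⊢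
  intro ε hε
  obtain ⟨δ, hδ, h⟩ := hf (ε / (K + 1)) (by positivity)
  refine ⟨δ, hδ, fun E hE hlen => ?_⟩
  have hfE := h E hE hlen
  rw [lt_div_iff₀ (by positivity)] at hfE
  refine lt_of_le_of_lt ?_ hfE
  rw [Finset.sum_mul]
  refine Finset.sum_le_sum fun i hi => ?_
  have hE' := hE.1 i hi
  refine (hg.dist_le_mul _ (hs hE'.1) _ (hs hE'.2)).trans ?_
  rw [mul_comm]
  exact mul_le_mul_of_nonneg_left (by linarith) dist_nonneg

theorem ContDiffOn.comp_absolutelyContinuousOnInterval {E F : Type*} [NormedAddCommGroup E]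
    [NormedSpace ℝ E] [NormedAddCommGroup F] [NormedSpace ℝ F] {g : E → F} {f : ℝ → E} {s : Set E}
    {a b : ℝ} (hg : ContDiffOn ℝ 1 g s) (hconv : Convex ℝ s) (hcomp : IsCompact s)
    (hf : AbsolutelyContinuousOnInterval f a b) (hs : MapsTo f (uIcc a b) s) :
    AbsolutelyContinuousOnInterval (fun t => g (f t)) a b := by
  obtain ⟨K, hK⟩ := hg.exists_lipschitzOnWith (by decide) hconv hcomp
  exact hK.comp_absolutelyContinuousOnInterval hf hs

theorem AbsolutelyContinuousOnInterval.norm_sq {n : ℕ} {f : ℝ → EuclideanSpace ℝ (Fin n)} {a b : ℝ}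
    (hf : AbsolutelyContinuousOnInterval f a b) :
    AbsolutelyContinuousOnInterval (fun t => ‖f t‖ ^ 2) a b := by
  obtain ⟨C, hC⟩ := hf.exists_bound
  have hg : ContDiffOn ℝ 1 (fun y : EuclideanSpace ℝ (Fin n) => ‖y‖ ^ 2)
      (Metric.closedBall 0 C) := (contDiff_norm_sq ℝ).contDiffOn
  have hmaps : MapsTo f (uIcc a b) (Metric.closedBall 0 C) := fun t ht => by
    rw [mem_closedBall_zero_iff]
    exact hC t ht
  exact hg.comp_absolutelyContinuousOnInterval (convex_closedBall 0 C)
    (isCompact_closedBall 0 C) hf hmaps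

/-! ### The lower bound for the length -/

/-- The Riccati function that completes the square in `∫ |y'|² - b² |y|²`. For `0 < b < π` it is
smooth on `[0, 1]`, which is the absence of conjugate points. -/
noncomputable def riccati (b σ : ℝ) : ℝ := -b * Real.tan (b * (σ - 1 / 2))

theorem cos_riccati_pos {b σ : ℝ} (hb : b ∈ Ioo 0 Real.pi) (hσ : σ ∈ Icc (0 : ℝ) 1) :
    0 < Real.cos (b * (σ - 1 / 2)) := by
  refine Real.cos_pos_of_mem_Ioo ⟨?_, ?_⟩
  · nlinarith [hb.1, hb.2, hσ.1]
  · nlinarith [hb.1, hb.2, hσ.2]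

theorem hasDerivAt_riccati {b σ : ℝ} (hc : Real.cos (b * (σ - 1 / 2)) ≠ 0) :
    HasDerivAt (riccati b) (-(b ^ 2 + riccati b σ ^ 2)) σ := by
  have h1 : HasDerivAt (fun σ => b * (σ - 1 / 2)) b σ := by
    have := ((hasDerivAt_id σ).sub_const (1 / 2)).const_mul b
    rwa [mul_one] at this
  refine (((Real.hasDerivAt_tan hc).comp σ h1).const_mul (-b)).congr_deriv ?_
  rw [riccati, one_div, ← Real.inv_one_add_tan_sq hc, inv_inv]
  ring

theorem contDiffOn_riccati {b : ℝ} (hb : b ∈ Ioo 0 Real.pi) :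
    ContDiffOn ℝ 1 (riccati b) (Icc 0 1) := by
  intro σ hσ
  have h1 : ContDiffAt ℝ 1 Real.tan (b * (σ - 1 / 2)) :=
    Real.contDiffAt_tan.2 (cos_riccati_pos hb hσ).ne'
  have h2 : ContDiffAt ℝ 1 (fun σ => b * (σ - 1 / 2)) σ := by fun_prop
  exact (contDiffAt_const.mul (h1.comp σ h2)).contDiffWithinAt

/-- The square root of `|y'|² + (u' / |y|)²` along `γ = (y, u)`. Where `y = 0` the quotient is zero,
which is the correct value for a horizontal velocity. -/
noncomputable def grushinSpeed {n : ℕ} (γ : ℝ → EuclideanSpace ℝ (Fin n) × ℝ) (t : ℝ) : ℝ :=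
  √(‖(deriv γ t).1‖ ^ 2 + ((deriv γ t).2 / ‖(γ t).1‖) ^ 2)

section LowerBound

variable {n : ℕ} {γ : ℝ → EuclideanSpace ℝ (Fin n) × ℝ}

theorem grushinSpeed_nonneg (t : ℝ) : 0 ≤ grushinSpeed γ t := Real.sqrt_nonneg _

theorem ofReal_grushinSpeed_le (t : ℝ) : ENNReal.ofReal (grushinSpeed γ t) ≤
    horizontalNormSq (grushinFields n) (γ t) (deriv γ t) ^ (1 / 2 : ℝ) := by
  rw [grushinSpeed, Real.sqrt_eq_rpow,
    ← ENNReal.ofReal_rpow_of_nonneg (by positivity) (by norm_num)]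
  exact ENNReal.rpow_le_rpow (ofReal_le_horizontalNormSq _ _) (by norm_num)

theorem aestronglyMeasurable_grushinSpeed (hγ : AbsolutelyContinuousOnInterval γ 0 1) :
    AEStronglyMeasurable (grushinSpeed γ) (volume.restrict (Icc 0 1)) := by
  have hcont : ContinuousOn γ (Icc 0 1) := by simpa using hγ.continuousOn
  have h1 : AEMeasurable (fun t => ‖(γ t).1‖) (volume.restrict (Icc 0 1)) :=
    (hcont.fst.norm.aestronglyMeasurable measurableSet_Icc).aemeasurable
  have h2 : Measurable (deriv γ) := measurable_deriv γ
  refine AEMeasurable.aestronglyMeasurable ?_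
  exact ((h2.fst.norm.pow_const 2).aemeasurable.add
    ((h2.snd.aemeasurable.div h1).pow_const 2)).sqrt

theorem lintegral_grushinSpeed_le :
    ∫⁻ t in Icc (0 : ℝ) 1, ENNReal.ofReal (grushinSpeed γ t) ≤ grushinLength γ :=
  lintegral_mono fun t => ofReal_grushinSpeed_le t

theorem integrableOn_grushinSpeed (hγ : AbsolutelyContinuousOnInterval γ 0 1)
    (hL : grushinLength γ ≠ ∞) : IntegrableOn (grushinSpeed γ) (Icc 0 1) := by
  refine ⟨aestronglyMeasurable_grushinSpeed hγ, ?_⟩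
  rw [hasFiniteIntegral_iff_ofReal (Filter.Eventually.of_forall grushinSpeed_nonneg)]
  exact lintegral_grushinSpeed_le.trans_lt hL.lt_top

theorem ofReal_integral_grushinSpeed_le (hγ : AbsolutelyContinuousOnInterval γ 0 1)
    (hL : grushinLength γ ≠ ∞) :
    ENNReal.ofReal (∫ t in (0 : ℝ)..1, grushinSpeed γ t) ≤ grushinLength γ := by
  rw [intervalIntegral.integral_of_le zero_le_one, ← integral_Icc_eq_integral_Ioc,
    ofReal_integral_eq_lintegral_ofReal (integrableOn_grushinSpeed hγ hL)
      (Filter.Eventually.of_forall grushinSpeed_nonneg)]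
  exact lintegral_grushinSpeed_le

/-- The pointwise calibration inequality. -/
theorem calibration_le {y v : EuclideanSpace ℝ (Fin n)} {p a b w : ℝ} (hy : y = 0 → p = 0)
    (ha : 0 < a) :
    b * p + 1 / 2 * (-(b ^ 2 + w ^ 2) * a * ‖y‖ ^ 2 + w * (2 * inner ℝ y v)) ≤
      (‖v‖ ^ 2 + (p / ‖y‖) ^ 2) / (2 * a) := by
  have hp : p = p / ‖y‖ * ‖y‖ := by
    by_cases h0 : y = 0
    · simp [h0, hy h0]
    · rw [div_mul_cancel₀ _ (norm_ne_zero_iff.2 h0)]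
  have hinner : w * inner ℝ y v ≤ |w| * (‖y‖ * ‖v‖) := by
    refine (le_abs_self _).trans ?_
    rw [abs_mul]
    exact mul_le_mul_of_nonneg_left (abs_real_inner_le_norm y v) (abs_nonneg w)
  generalize p / ‖y‖ = r at *
  rw [hp, le_div_iff₀ (by positivity)]
  have hw := sq_abs w
  have h1 := mul_le_mul_of_nonneg_left hinner ha.le
  have h2 : |w| ^ 2 * (a ^ 2 * ‖y‖ ^ 2) = w ^ 2 * (a ^ 2 * ‖y‖ ^ 2) := by rw [hw]
  linarith [sq_nonneg (r - a * b * ‖y‖), sq_nonneg (‖v‖ - a * |w| * ‖y‖)]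

/-- The calibration `b u + w(τ) |y|² / 2` along a horizontal curve, where `w` is `riccati b` and
`τ` is the proportion of the length covered. Adding `ε` to the speed keeps `τ' > 0`. -/
theorem calibration_sub_le (hγ : IsHorizontalCurve (grushinFields n) γ)
    (hs : IntegrableOn (grushinSpeed γ) (Icc 0 1)) {b ε : ℝ} (hb : b ∈ Ioo 0 Real.pi)
    (hε : 0 < ε) :
    (b * (γ 1).2 + 1 / 2 * (riccati b 1 * ‖(γ 1).1‖ ^ 2)) -
        (b * (γ 0).2 + 1 / 2 * (riccati b 0 * ‖(γ 0).1‖ ^ 2)) ≤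
      (∫ t in (0 : ℝ)..1, grushinSpeed γ t) *
        ((∫ t in (0 : ℝ)..1, grushinSpeed γ t) + ε) / 2 := by
  obtain ⟨hac, hspan⟩ := hγ
  have hsi : IntervalIntegrable (grushinSpeed γ) volume 0 1 :=
    (intervalIntegrable_iff_integrableOn_Icc_of_le zero_le_one).2 hs
  have hsε : IntervalIntegrable (fun t => grushinSpeed γ t + ε) volume 0 1 :=
    hsi.add intervalIntegrable_const
  set ℓ : ℝ := ∫ t in (0 : ℝ)..1, grushinSpeed γ t with hℓ
  have hℓ0 : 0 ≤ ℓ := intervalIntegral.integral_nonneg zero_le_one fun t _ => grushinSpeed_nonneg t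
  let τ : ℝ → ℝ := fun t => (ℓ + ε)⁻¹ * ∫ r in (0 : ℝ)..t, (grushinSpeed γ r + ε)
  have hτ0 : τ 0 = 0 := by simp [τ]
  have hτ1 : τ 1 = 1 := by
    have : ∫ r in (0 : ℝ)..1, (grushinSpeed γ r + ε) = ℓ + ε := by
      rw [intervalIntegral.integral_add hsi intervalIntegrable_const]
      simp [hℓ]
    simp only [τ, this]
    exact inv_mul_cancel₀ (by positivity)
  have hτac : AbsolutelyContinuousOnInterval τ 0 1 :=
    (hsε.absolutelyContinuousOnInterval_intervalIntegral (by simp)).const_mul _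
  have hτmem : MapsTo τ (uIcc 0 1) (Icc 0 1) := by
    intro t ht
    rw [uIcc_of_le zero_le_one] at ht
    have hpos : ∀ r, 0 ≤ grushinSpeed γ r + ε := fun r => add_nonneg (grushinSpeed_nonneg r) hε.le
    refine ⟨mul_nonneg (by positivity) (intervalIntegral.integral_nonneg ht.1 fun r _ => hpos r), ?_⟩
    rw [← hτ1]
    refine mul_le_mul_of_nonneg_left ?_ (by positivity)
    exact intervalIntegral.integral_mono_interval le_rfl ht.1 ht.2
      (Filter.Eventually.of_forall hpos) hsε
  have hfst : AbsolutelyContinuousOnInterval (fun t => (γ t).1) 0 1 :=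
    (LipschitzWith.prod_fst.lipschitzOnWith (s := univ)).comp_absolutelyContinuousOnInterval hac
      (mapsTo_univ _ _)
  have hsnd : AbsolutelyContinuousOnInterval (fun t => (γ t).2) 0 1 :=
    (LipschitzWith.prod_snd.lipschitzOnWith (s := univ)).comp_absolutelyContinuousOnInterval hac
      (mapsTo_univ _ _)
  let S : ℝ → ℝ := fun t => b * (γ t).2 + 1 / 2 * (riccati b (τ t) * ‖(γ t).1‖ ^ 2)
  have hSac : AbsolutelyContinuousOnInterval S 0 1 :=
    (hsnd.const_mul b).add ((((contDiffOn_riccati hb).comp_absolutelyContinuousOnInterval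
      (convex_Icc 0 1) isCompact_Icc hτac hτmem).mul hfst.norm_sq).const_mul (1 / 2))
  have hle : deriv S ≤ᵐ[volume.restrict (Icc 0 1)] fun t => (ℓ + ε) / 2 * grushinSpeed γ t := by
    filter_upwards [hspan, ae_restrict_of_ae hac.boundedVariationOn.ae_differentiableAt_of_mem_uIcc,
      ae_restrict_of_ae hsε.ae_hasDerivAt_integral, ae_restrict_mem measurableSet_Icc]
      with t hspan_t hdiff hint ht
    have ht' : t ∈ uIcc (0 : ℝ) 1 := by rwa [uIcc_of_le zero_le_one]
    have hγ' := (hdiff ht').hasDerivAt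
    have hτ' : HasDerivAt τ ((ℓ + ε)⁻¹ * (grushinSpeed γ t + ε)) t :=
      (hint ht' 0 (by simp)).const_mul _
    have hw := (hasDerivAt_riccati (cos_riccati_pos hb (hτmem ht')).ne').comp t hτ'
    have hγ₁ : HasDerivAt (fun t => (γ t).1) (deriv γ t).1 t := by
      simpa using hγ'.hasFDerivAt.fst.hasDerivAt
    have hγ₂ : HasDerivAt (fun t => (γ t).2) (deriv γ t).2 t := by
      simpa using hγ'.hasFDerivAt.snd.hasDerivAt
    have hS : HasDerivAt S (b * (deriv γ t).2 + 1 / 2 * (-(b ^ 2 + riccati b (τ t) ^ 2) *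
        ((ℓ + ε)⁻¹ * (grushinSpeed γ t + ε)) * ‖(γ t).1‖ ^ 2 +
          riccati b (τ t) * (2 * inner ℝ (γ t).1 (deriv γ t).1))) t :=
      (hγ₂.const_mul b).add ((hw.mul hγ₁.norm_sq).const_mul (1 / 2))
    have hs0 := grushinSpeed_nonneg (γ := γ) t
    have ha : 0 < (ℓ + ε)⁻¹ * (grushinSpeed γ t + ε) := by positivity
    rw [hS.deriv]
    refine (calibration_le (fun h0 => snd_eq_zero_of_mem_span_grushinFields hspan_t h0) ha).trans ?_
    have hsq : ‖(deriv γ t).1‖ ^ 2 + ((deriv γ t).2 / ‖(γ t).1‖) ^ 2 = grushinSpeed γ t ^ 2 := by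
      rw [grushinSpeed, Real.sq_sqrt (by positivity)]
    rw [hsq, div_le_iff₀ (by positivity)]
    have h3 : (ℓ + ε) / 2 * grushinSpeed γ t *
        (2 * ((ℓ + ε)⁻¹ * (grushinSpeed γ t + ε))) =
        grushinSpeed γ t * (grushinSpeed γ t + ε) := by
      field_simp
    rw [h3, sq]
    exact mul_le_mul_of_nonneg_left (by linarith) hs0
  have hfin := intervalIntegral.integral_mono_ae_restrict zero_le_one hSac.intervalIntegrable_deriv
    (hsi.const_mul ((ℓ + ε) / 2)) hle
  rw [hSac.integral_deriv_eq_sub, intervalIntegral.integral_const_mul, ← hℓ] at hfin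
  simp only [S, hτ0, hτ1] at hfin
  linarith

/-- The squared length of a horizontal curve from `(x, 0)` to `(x, u)` is bounded from below
for every frequency `b` in `(0, π)`. -/
theorem IsHorizontalCurve.ofReal_sqrt_le_grushinLength {x : EuclideanSpace ℝ (Fin n)} {u b : ℝ}
    (hγ : IsHorizontalCurve (grushinFields n) γ) (h0 : γ 0 = (x, 0)) (h1 : γ 1 = (x, u))
    (hb : b ∈ Ioo 0 Real.pi) :
    ENNReal.ofReal (√(2 * b * u - 2 * ‖x‖ ^ 2 * b * Real.tan (b / 2))) ≤ grushinLength γ := by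
  rcases eq_or_ne (grushinLength γ) ∞ with htop | hL
  · rw [htop]
    exact le_top
  refine le_trans (ENNReal.ofReal_le_ofReal ?_) (ofReal_integral_grushinSpeed_le hγ.1 hL)
  have hs := integrableOn_grushinSpeed hγ.1 hL
  have hcal := fun ε (hε : 0 < ε) => calibration_sub_le hγ hs hb hε
  set ℓ : ℝ := ∫ t in (0 : ℝ)..1, grushinSpeed γ t
  have hℓ0 : 0 ≤ ℓ := intervalIntegral.integral_nonneg zero_le_one fun t _ => grushinSpeed_nonneg t
  have hr1 : riccati b 1 = -b * Real.tan (b / 2) := by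
    rw [riccati]
    congr 2
    ring
  have hr0 : riccati b 0 = b * Real.tan (b / 2) := by
    rw [riccati, show b * (0 - 1 / 2) = -(b / 2) by ring, Real.tan_neg]
    ring
  simp only [h0, h1, hr0, hr1] at hcal
  rw [Real.sqrt_le_left hℓ0]
  refine le_of_forall_pos_le_add fun δ hδ => ?_
  have h2 := hcal (δ / (ℓ + 1)) (by positivity)
  have h3 : ℓ * (δ / (ℓ + 1)) ≤ δ := by
    rw [mul_div_assoc', div_le_iff₀ (by positivity)]
    nlinarith
  linarith

end LowerBound

/-! ### Geodesics between points of the same vertical line -/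

section Classification

variable {n : ℕ} {x : EuclideanSpace ℝ (Fin n)} {u b : ℝ}

theorem IsMuHatSolution.pos (hx : x ≠ 0) (hu : 0 < u) (hb : IsMuHatSolution x u b) : 0 < b := by
  have hn : 0 < ‖x‖ := norm_pos_iff.2 hx
  exact pos_of_add_sin_eq (by positivity) ((isMuHatSolution_iff x u b).1 hb)

theorem IsMuHatSolution.eq_mul_muHat (hx : x ≠ 0) (hb : IsMuHatSolution x u b) :
    u = ‖x‖ ^ 2 * muHat (b / 2) := by
  have hn : ‖x‖ ≠ 0 := norm_ne_zero_iff.2 hx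
  rw [← hb.2]
  field_simp

theorem grushinCurveReturn_one (hb : b ≠ 0) (hc : Real.cos (b / 2) ≠ 0) :
    grushinCurveReturn x b 1 = (x, ‖x‖ ^ 2 * muHat (b / 2)) := by
  obtain ⟨φ, rfl⟩ : ∃ φ, b = 2 * φ := ⟨b / 2, by ring⟩
  have hφ : φ ≠ 0 := by simpa using hb
  have hsq := Real.sin_sq φ
  rw [mul_div_cancel_left₀ φ two_ne_zero] at hc ⊢
  rw [grushinCurveReturn, grushinCurve, if_neg hb, mul_div_cancel_left₀ φ two_ne_zero]
  refine Prod.ext ?_ ?_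
  · have : Real.sin (2 * φ * 1) / (2 * φ) * (2 * φ * Real.tan φ) + Real.cos (2 * φ * 1) = 1 := by
      rw [mul_one, Real.sin_two_mul, Real.cos_two_mul, Real.tan_eq_sin_div_cos]
      field_simp
      linear_combination 2 * hsq
    simp only [smul_smul, ← add_smul, this, one_smul]
  · simp only [norm_smul, mul_pow, Real.norm_eq_abs, sq_abs, real_inner_smul_right,
      real_inner_self_eq_norm_sq, muHat, mul_one, add_zero]
    have h4 : Real.sin (2 * (2 * φ)) = 2 * Real.sin (2 * φ) * Real.cos (2 * φ) :=
      Real.sin_two_mul _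
    have hs : Real.sin φ ^ 2 = 1 - Real.cos φ ^ 2 := hsq
    rw [h4, Real.sin_two_mul, Real.cos_two_mul, Real.tan_eq_sin_div_cos]
    generalize Real.sin φ = s at *
    generalize Real.cos φ = c at *
    have hs4 : s ^ 3 = s * (1 - c ^ 2) := by rw [← hs]; ring
    field_simp
    ring_nf
    simp only [hs4, hs]
    ring

theorem isGeodesicFromTo_grushinCurveReturn (hx : x ≠ 0) (hu : 0 < u)
    (hb : IsMuHatSolution x u b) : IsGeodesicFromTo (x, 0) (x, u) (grushinCurveReturn x b) := by
  have hb0 := (hb.pos hx hu).ne'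
  refine ⟨isGrushinGeodesic_grushinCurve x _ hb0, grushinCurve_zero x _ hb0, ?_⟩
  rw [grushinCurveReturn_one hb0 hb.1, ← hb.eq_mul_muHat hx]

theorem grushinLength_grushinCurveReturn (hb : b ≠ 0) (hc : Real.cos (b / 2) ≠ 0) :
    grushinLength (grushinCurveReturn x b) =
      ENNReal.ofReal (√(b ^ 2 / Real.cos (b / 2) ^ 2 * ‖x‖ ^ 2)) := by
  rw [grushinCurveReturn, grushinLength_grushinCurve x _ hb, norm_smul, Real.norm_eq_abs, mul_pow,
    sq_abs, ← Real.inv_one_add_tan_sq hc, div_inv_eq_mul]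
  congr 2
  ring

theorem IsMuHatSolution.sq_length_eq (hx : x ≠ 0) (hb : IsMuHatSolution x u b) :
    b ^ 2 / Real.cos (b / 2) ^ 2 * ‖x‖ ^ 2 =
      2 * b * u - 2 * ‖x‖ ^ 2 * b * Real.tan (b / 2) := by
  rw [hb.eq_mul_muHat hx, muHat]
  ring

theorem grushinLength_grushinCurveReturn_lt (hx : x ≠ 0) (hu : 0 < u) {b' : ℝ}
    (hb : IsMuHatSolution x u b) (hb' : IsMuHatSolution x u b') (hlt : b < b') :
    grushinLength (grushinCurveReturn x b) < grushinLength (grushinCurveReturn x b') := by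
  have hpos := hb.pos hx hu
  have hn : 0 < ‖x‖ := norm_pos_iff.2 hx
  have hc' := hb'.1
  have h := sq_div_cos_sq_lt (half_pos hpos) (by linarith) hb.1 hb'.1 hb.2.symm hb'.2.symm
  have hb'pos := hpos.trans hlt
  rw [grushinLength_grushinCurveReturn hpos.ne' hb.1,
    grushinLength_grushinCurveReturn hb'pos.ne' hb'.1,
    ENNReal.ofReal_lt_ofReal_iff (by positivity)]
  refine Real.sqrt_lt_sqrt (by positivity) (mul_lt_mul_of_pos_right ?_ (by positivity))
  rw [div_pow, div_pow, div_div, div_div, mul_comm, mul_comm (2 ^ 2 : ℝ), ← div_div,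
    ← div_div] at h
  have h2 := mul_lt_mul_of_pos_right h (show (0 : ℝ) < 2 ^ 2 by norm_num)
  rwa [div_mul_cancel₀ _ (by norm_num), div_mul_cancel₀ _ (by norm_num)] at h2

theorem grushinCurve_full_turns {m : ℕ} (hm : 1 ≤ m) (c : EuclideanSpace ℝ (Fin n)) :
    grushinCurve x 0 (2 * m * Real.pi) c 1 =
      (x, ‖c‖ ^ 2 / (4 * m * Real.pi) + ‖x‖ ^ 2 * (m * Real.pi)) := by
  have hm' : (m : ℝ) ≠ 0 := by positivity
  have hb : 2 * m * Real.pi ≠ 0 := by positivity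
  have h1 : Real.sin (2 * m * Real.pi) = 0 := by
    simpa using Real.sin_nat_mul_pi (2 * m)
  have h2 : Real.cos (2 * m * Real.pi) = 1 := by
    rw [show 2 * (m : ℝ) * Real.pi = m * (2 * Real.pi) by ring, Real.cos_nat_mul_two_pi]
  have h3 : Real.sin (2 * (2 * m * Real.pi)) = 0 := by
    rw [Real.sin_two_mul, h1]
    ring
  rw [grushinCurve, if_neg hb]
  simp only [mul_one, h1, h2, h3]
  refine Prod.ext (by simp) ?_
  simp only
  field_simp
  ring

section FullTurns

variable {m : ℕ} {c : EuclideanSpace ℝ (Fin n)}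

theorem norm_sq_of_full_turns (h : m * Real.pi * ‖x‖ ^ 2 ≤ u)
    (hc : ‖c‖ = 2 * √(m * Real.pi * u - (m * Real.pi) ^ 2 * ‖x‖ ^ 2)) :
    ‖c‖ ^ 2 = 4 * (m * Real.pi * u - (m * Real.pi) ^ 2 * ‖x‖ ^ 2) := by
  have h0 : 0 ≤ m * Real.pi * (u - m * Real.pi * ‖x‖ ^ 2) :=
    mul_nonneg (by positivity) (by linarith)
  rw [hc, mul_pow, Real.sq_sqrt (by linarith)]
  norm_num

theorem isGeodesicFromTo_grushinCurve_full_turns (hm : 1 ≤ m) (h : m * Real.pi * ‖x‖ ^ 2 ≤ u)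
    (hc : ‖c‖ = 2 * √(m * Real.pi * u - (m * Real.pi) ^ 2 * ‖x‖ ^ 2)) :
    IsGeodesicFromTo (x, 0) (x, u) (grushinCurve x 0 (2 * m * Real.pi) c) := by
  have hm' : (m : ℝ) ≠ 0 := by positivity
  have hb : 2 * m * Real.pi ≠ 0 := by positivity
  refine ⟨isGrushinGeodesic_grushinCurve x c hb, grushinCurve_zero x c hb, ?_⟩
  rw [grushinCurve_full_turns hm, norm_sq_of_full_turns h hc]
  refine Prod.ext rfl ?_
  simp only
  field_simp
  ring

theorem grushinLength_grushinCurve_full_turns (hm : 1 ≤ m) (h : m * Real.pi * ‖x‖ ^ 2 ≤ u)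
    (hc : ‖c‖ = 2 * √(m * Real.pi * u - (m * Real.pi) ^ 2 * ‖x‖ ^ 2)) :
    grushinLength (grushinCurve x 0 (2 * m * Real.pi) c) =
      ENNReal.ofReal (2 * √(m * Real.pi * u)) := by
  have hb : 2 * m * Real.pi ≠ 0 := by positivity
  rw [grushinLength_grushinCurve x c hb, norm_sq_of_full_turns h hc]
  congr 1
  rw [show 4 * (m * Real.pi * u - (m * Real.pi) ^ 2 * ‖x‖ ^ 2) + (2 * m * Real.pi) ^ 2 * ‖x‖ ^ 2 =
    2 ^ 2 * (m * Real.pi * u) by ring, Real.sqrt_mul (by positivity), Real.sqrt_sq two_pos.le]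

end FullTurns

/-- The endpoint condition for `γ^{b,c}` reads `cos (b / 2) c = b sin (b / 2) x` after division by
`sin (b / 2)`; it leaves `c` free when `sin (b / 2) = 0` and determines it otherwise. -/
theorem eq_smul_of_oscillatorPosition_one_eq {c : EuclideanSpace ℝ (Fin n)} (hx : x ≠ 0)
    (hb : b ≠ 0) (hs : Real.sin (b / 2) ≠ 0) (h : oscillatorPosition x b c 1 = x) :
    Real.cos (b / 2) ≠ 0 ∧ c = (b * Real.tan (b / 2)) • x := by
  obtain ⟨φ, rfl⟩ : ∃ φ, b = 2 * φ := ⟨b / 2, by ring⟩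
  rw [mul_div_cancel_left₀ φ two_ne_zero] at hs ⊢
  have hφ : φ ≠ 0 := by simpa using hb
  have hsq := Real.sin_sq φ
  rw [oscillatorPosition, mul_one, Real.sin_two_mul, Real.cos_two_mul] at h
  have h1 : Real.cos φ • c = (2 * φ * Real.sin φ) • x := by
    have h2 : (2 * Real.sin φ / (2 * φ)) • (Real.cos φ • c) =
        (2 * Real.sin φ / (2 * φ)) • ((2 * φ * Real.sin φ) • x) := by
      rw [smul_smul, smul_smul]
      have h3 : 2 * Real.sin φ / (2 * φ) * (2 * φ * Real.sin φ) =
          1 - (2 * Real.cos φ ^ 2 - 1) := by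
        field_simp
        linear_combination 2 * hsq
      rw [h3, sub_smul, one_smul, ← eq_sub_of_add_eq h]
      congr 1
      ring
    exact smul_right_injective _ (by positivity : 2 * Real.sin φ / (2 * φ) ≠ 0) h2
  have hc : Real.cos φ ≠ 0 := by
    intro h0
    rw [h0, zero_smul, eq_comm, smul_eq_zero] at h1
    exact h1.elim (mul_ne_zero hb hs) hx
  refine ⟨hc, ?_⟩
  rw [← inv_smul_smul₀ hc c, h1, smul_smul, Real.tan_eq_sin_div_cos]
  congr 1
  field_simp

theorem exists_full_turns_of_sin_eq_zero {c : EuclideanSpace ℝ (Fin n)} (hu : 0 < u) (hb : b ≠ 0)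
    (hs : Real.sin (b / 2) = 0) (h : (grushinCurve x 0 b c 1).2 = u) :
    ∃ m : ℕ, 1 ≤ m ∧ m * Real.pi * ‖x‖ ^ 2 ≤ u ∧ b = 2 * m * Real.pi ∧
      ‖c‖ = 2 * √(m * Real.pi * u - (m * Real.pi) ^ 2 * ‖x‖ ^ 2) := by
  have hpos : 0 < b := by
    -- the height has derivative `b |y|²`, so it cannot increase for `b < 0`
    by_contra! hle
    have hanti : Antitone fun s => (grushinCurve x 0 b c s).2 :=
      antitone_of_hasDerivAt_nonpos (fun t => hasDerivAt_grushinCurve_snd x c hb t) fun t =>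
        mul_nonpos_of_nonpos_of_nonneg hle (sq_nonneg _)
    have := hanti zero_le_one
    simp only [grushinCurve_zero x c hb, h] at this
    linarith
  obtain ⟨k, hk⟩ := Real.sin_eq_zero_iff.1 hs
  have hkpos : 0 < k := by
    have : 0 < (k : ℝ) * Real.pi := by rw [hk]; positivity
    exact_mod_cast pos_of_mul_pos_left this Real.pi_pos.le
  lift k to ℕ using hkpos.le with m
  have hm : 1 ≤ m := by exact_mod_cast hkpos
  have hbm : b = 2 * m * Real.pi := by
    push_cast at hk
    linarith
  have hmp : 0 < m * Real.pi := by positivity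
  rw [hbm, grushinCurve_full_turns hm] at h
  have hA : m * Real.pi * u - (m * Real.pi) ^ 2 * ‖x‖ ^ 2 = (‖c‖ / 2) ^ 2 := by
    rw [← h]
    field_simp
    ring
  refine ⟨m, hm, ?_, hbm, ?_⟩
  · rw [← h]
    have : 0 ≤ ‖c‖ ^ 2 / (4 * m * Real.pi) := by positivity
    linarith
  · rw [hA, Real.sqrt_sq (by positivity)]
    ring

theorem isGeodesicFromTo_vertical_iff (hx : x ≠ 0) (hu : 0 < u)
    (γ : ℝ → EuclideanSpace ℝ (Fin n) × ℝ) :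
    IsGeodesicFromTo (x, 0) (x, u) γ ↔
      (∃ b : ℝ, IsMuHatSolution x u b ∧ EqOn γ (grushinCurveReturn x b) (Icc 0 1)) ∨
      (∃ m : ℕ, 1 ≤ m ∧ m * Real.pi * ‖x‖ ^ 2 ≤ u ∧
        ∃ c : EuclideanSpace ℝ (Fin n),
          ‖c‖ = 2 * √(m * Real.pi * u - (m * Real.pi) ^ 2 * ‖x‖ ^ 2) ∧
          EqOn γ (grushinCurve x 0 (2 * m * Real.pi) c) (Icc 0 1)) := by
  constructor
  · intro hγ
    obtain ⟨b, hb, c, heq⟩ := hγ.exists_eqOn_grushinCurve hu.ne'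
    have h1 : grushinCurve x 0 b c 1 = (x, u) := by rw [← heq (by simp), hγ.2.2]
    by_cases hs : Real.sin (b / 2) = 0
    · obtain ⟨m, hm, hmu, rfl, hc⟩ :=
        exists_full_turns_of_sin_eq_zero (x := x) (c := c) hu hb hs (by rw [h1])
      exact Or.inr ⟨m, hm, hmu, c, hc, heq⟩
    · obtain ⟨hc, rfl⟩ := eq_smul_of_oscillatorPosition_one_eq hx hb hs
        (by rw [← grushinCurve_fst x c hb, h1])
      refine Or.inl ⟨b, ⟨hc, ?_⟩, heq⟩
      have h2 := grushinCurveReturn_one (x := x) hb hc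
      rw [grushinCurveReturn, h1, Prod.mk.injEq] at h2
      have hn : ‖x‖ ≠ 0 := norm_ne_zero_iff.2 hx
      rw [h2.2]
      field_simp
  · rintro (⟨b, hb, heq⟩ | ⟨m, hm, hmu, c, hc, heq⟩)
    · exact (isGeodesicFromTo_grushinCurveReturn hx hu hb).congr heq
    · exact (isGeodesicFromTo_grushinCurve_full_turns hm hmu hc).congr heq

theorem finite_setOf_full_turns (hx : x ≠ 0) :
    {m : ℕ | 1 ≤ m ∧ m * Real.pi * ‖x‖ ^ 2 ≤ u}.Finite := by
  have hn : 0 < ‖x‖ := norm_pos_iff.2 hx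
  refine (finite_Iic ⌊u / (Real.pi * ‖x‖ ^ 2)⌋₊).subset fun m hm => Nat.le_floor ?_
  rw [le_div_iff₀ (by positivity)]
  linarith [hm.2]

theorem finite_sphere_fin_one (r : ℝ) : {c : EuclideanSpace ℝ (Fin 1) | ‖c‖ = r}.Finite := by
  refine ((toFinite {r, -r}).image (EuclideanSpace.single (0 : Fin 1))).subset fun c hc => ?_
  have h1 : c 0 ^ 2 = r ^ 2 := by
    have := EuclideanSpace.real_norm_sq_eq c
    rw [show ‖c‖ = r from hc] at this
    simpa using this.symm
  refine ⟨c 0, by simpa using sq_eq_sq_iff_eq_or_eq_neg.1 h1, ?_⟩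
  ext i
  fin_cases i
  simp

theorem finite_image_geodesics (hx : x ≠ 0) (hu : 0 < u) (h : n = 1 ∨ u ≤ Real.pi * ‖x‖ ^ 2) :
    ((fun (γ : ℝ → EuclideanSpace ℝ (Fin n) × ℝ) (t : Icc (0 : ℝ) 1) => γ t) ''
      {γ | IsGeodesicFromTo (x, 0) (x, u) γ}).Finite := by
  have hn : 0 < ‖x‖ := norm_pos_iff.2 hx
  have hfin : {b : ℝ | IsMuHatSolution x u b}.Finite := by
    simp only [isMuHatSolution_iff]
    exact finite_setOf_add_sin_eq (by positivity)
  have hsphere : ∀ m ∈ {m : ℕ | 1 ≤ m ∧ m * Real.pi * ‖x‖ ^ 2 ≤ u},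
      {c : EuclideanSpace ℝ (Fin n) |
        ‖c‖ = 2 * √(m * Real.pi * u - (m * Real.pi) ^ 2 * ‖x‖ ^ 2)}.Finite := by
    rintro m ⟨hm, -⟩
    rcases h with rfl | h
    · exact finite_sphere_fin_one _
    · -- the radius vanishes: `u ≤ π |x|² ≤ m π |x|²`
      refine (finite_singleton 0).subset fun c hc => ?_
      have hm' : (1 : ℝ) ≤ m := by exact_mod_cast hm
      have h1 : Real.pi * ‖x‖ ^ 2 ≤ m * (Real.pi * ‖x‖ ^ 2) :=
        le_mul_of_one_le_left (by positivity) hm'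
      have h2 : m * Real.pi * (u - m * Real.pi * ‖x‖ ^ 2) ≤ 0 :=
        mul_nonpos_of_nonneg_of_nonpos (by positivity) (by linarith)
      have h3 : √(m * Real.pi * u - (m * Real.pi) ^ 2 * ‖x‖ ^ 2) = 0 :=
        Real.sqrt_eq_zero_of_nonpos (by linarith)
      have hc' : ‖c‖ = 2 * √(m * Real.pi * u - (m * Real.pi) ^ 2 * ‖x‖ ^ 2) := hc
      rw [h3, mul_zero, norm_eq_zero] at hc'
      exact hc'
  refine ((hfin.image fun b (t : Icc (0 : ℝ) 1) => grushinCurveReturn x b t).union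
    ((finite_setOf_full_turns (u := u) hx).biUnion fun m hm => (hsphere m hm).image
      fun c (t : Icc (0 : ℝ) 1) => grushinCurve x 0 (2 * m * Real.pi) c t)).subset ?_
  rintro _ ⟨γ, hγ, rfl⟩
  rcases (isGeodesicFromTo_vertical_iff hx hu γ).1 hγ with ⟨b, hb, heq⟩ | ⟨m, hm, hmu, c, hc, heq⟩
  · exact Or.inl ⟨b, hb, funext fun t => (heq t.2).symm⟩
  · exact Or.inr (mem_biUnion (show m ∈ {m : ℕ | 1 ≤ m ∧ _} from ⟨hm, hmu⟩)
      ⟨c, hc, funext fun t => (heq t.2).symm⟩)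

end Classification

/-! ### The shortest geodesic -/

section Shortest

variable {n : ℕ} {x : EuclideanSpace ℝ (Fin n)} {u b : ℝ}

theorem existsUnique_isMuHatSolution (hx : x ≠ 0) (hu : 0 < u) :
    ∃! b : ℝ, b ∈ Ioo 0 Real.pi ∧ IsMuHatSolution x u b := by
  have hn : 0 < ‖x‖ := norm_pos_iff.2 hx
  simp only [isMuHatSolution_iff]
  exact existsUnique_add_sin_eq (by positivity)

theorem grushinLength_grushinCurveReturn_lt_of_ne (hx : x ≠ 0) (hu : 0 < u)
    (hb : b ∈ Ioo 0 Real.pi) (hsol : IsMuHatSolution x u b)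
    {γ : ℝ → EuclideanSpace ℝ (Fin n) × ℝ} (hγ : IsGeodesicFromTo (x, 0) (x, u) γ)
    (hne : ¬ EqOn γ (grushinCurveReturn x b) (Icc 0 1)) :
    grushinLength (grushinCurveReturn x b) < grushinLength γ := by
  have hn : 0 < ‖x‖ := norm_pos_iff.2 hx
  rcases (isGeodesicFromTo_vertical_iff hx hu γ).1 hγ with
    ⟨b', hb', heq⟩ | ⟨m, hm, hmu, c, hc, heq⟩
  · rw [grushinLength_congr heq]
    refine grushinLength_grushinCurveReturn_lt hx hu hsol hb' ?_
    by_contra! hle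
    refine hne ?_
    rwa [(existsUnique_isMuHatSolution hx hu).unique ⟨hb, hsol⟩
      ⟨⟨hb'.pos hx hu, hle.trans_lt hb.2⟩, hb'⟩]
  · have hm' : (1 : ℝ) ≤ m := by exact_mod_cast hm
    rw [grushinLength_congr heq, grushinLength_grushinCurve_full_turns hm hmu hc,
      grushinLength_grushinCurveReturn hb.1.ne' hsol.1, ENNReal.ofReal_lt_ofReal_iff (by positivity),
      hsol.sq_length_eq hx, show (2 : ℝ) = √(2 ^ 2) by rw [Real.sqrt_sq two_pos.le],
      ← Real.sqrt_mul (by positivity), Real.sqrt_sq two_pos.le]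
    apply Real.sqrt_lt_sqrt
    · rw [← hsol.sq_length_eq hx]
      positivity
    · have htan : 0 < Real.tan (b / 2) :=
        Real.tan_pos_of_pos_of_lt_pi_div_two (half_pos hb.1) (by linarith [hb.2])
      have h1 : 0 < 2 * ‖x‖ ^ 2 * b * Real.tan (b / 2) := by
        have := hb.1
        positivity
      have h2 : b * u < Real.pi * u := mul_lt_mul_of_pos_right hb.2 hu
      have h3 : 1 * (Real.pi * u) ≤ m * (Real.pi * u) :=
        mul_le_mul_of_nonneg_right hm' (by positivity)
      have h4 : 0 < Real.pi * u := by positivity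
      linarith

theorem sqrt_eq_div_cos_mul_norm (hb : b ∈ Ioo 0 Real.pi) :
    √(b ^ 2 / Real.cos (b / 2) ^ 2 * ‖x‖ ^ 2) = b / Real.cos (b / 2) * ‖x‖ := by
  have hcos : 0 < Real.cos (b / 2) :=
    Real.cos_pos_of_mem_Ioo ⟨by linarith [hb.1, Real.pi_pos], by linarith [hb.2]⟩
  have := hb.1
  rw [← div_pow, ← mul_pow, Real.sqrt_sq (by positivity)]

theorem grushinDist_eq_grushinLength (hx : x ≠ 0) (hu : 0 < u) (hb : b ∈ Ioo 0 Real.pi)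
    (hsol : IsMuHatSolution x u b) :
    grushinDist (x, 0) (x, u) = grushinLength (grushinCurveReturn x b) := by
  refine le_antisymm ?_ (le_iInf₂ fun γ hγ => ?_)
  · have hgeo := isGeodesicFromTo_grushinCurveReturn hx hu hsol
    exact iInf₂_le _ ⟨isHorizontalCurve_grushinCurve x _ hb.1.ne', hgeo.2.1, hgeo.2.2⟩
  · rw [grushinLength_grushinCurveReturn hb.1.ne' hsol.1, hsol.sq_length_eq hx]
    exact hγ.1.ofReal_sqrt_le_grushinLength hγ.2.1 hγ.2.2 hb

end Shortest

theorem mainTheorem5 (n : ℕ) (x : EuclideanSpace ℝ (Fin n)) (hx : x ≠ 0) (u : ℝ) (hu : 0 < u) :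
    -- the geodesics from `(x, 0)` to `(x, u)` are exactly those of the two kinds
    (∀ γ : ℝ → EuclideanSpace ℝ (Fin n) × ℝ,
      IsGeodesicFromTo (x, 0) (x, u) γ ↔
        (∃ b : ℝ, IsMuHatSolution x u b ∧ EqOn γ (grushinCurveReturn x b) (Icc 0 1)) ∨
        (∃ m : ℕ, 1 ≤ m ∧ m * Real.pi * ‖x‖ ^ 2 ≤ u ∧
          ∃ c : EuclideanSpace ℝ (Fin n),
            ‖c‖ = 2 * √(m * Real.pi * u - (m * Real.pi) ^ 2 * ‖x‖ ^ 2) ∧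
            EqOn γ (grushinCurve x 0 (2 * m * Real.pi) c) (Icc 0 1))) ∧
    -- finiteness, up to the choice of the direction of `c` in the second kind
    {b : ℝ | IsMuHatSolution x u b}.Finite ∧
    {m : ℕ | 1 ≤ m ∧ m * Real.pi * ‖x‖ ^ 2 ≤ u}.Finite ∧
    (n = 1 ∨ u ≤ Real.pi * ‖x‖ ^ 2 →
      ((fun (γ : ℝ → EuclideanSpace ℝ (Fin n) × ℝ) (t : Icc (0 : ℝ) 1) => γ t) ''
        {γ | IsGeodesicFromTo (x, 0) (x, u) γ}).Finite) ∧
    -- the first kind: lengths, strictly increasing with `b`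
    (∀ b : ℝ, IsMuHatSolution x u b →
      IsGeodesicFromTo (x, 0) (x, u) (grushinCurveReturn x b) ∧
      grushinLength (grushinCurveReturn x b) ^ 2 =
        ENNReal.ofReal (b ^ 2 / Real.cos (b / 2) ^ 2 * ‖x‖ ^ 2) ∧
      b ^ 2 / Real.cos (b / 2) ^ 2 * ‖x‖ ^ 2 =
        2 * b * u - 2 * ‖x‖ ^ 2 * b * Real.tan (b / 2)) ∧
    (∀ b b' : ℝ, IsMuHatSolution x u b → IsMuHatSolution x u b' → b < b' →
      grushinLength (grushinCurveReturn x b) < grushinLength (grushinCurveReturn x b')) ∧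
    -- the second kind: existence and lengths
    (∀ m : ℕ, 1 ≤ m → m * Real.pi * ‖x‖ ^ 2 ≤ u →
      (∃ c : EuclideanSpace ℝ (Fin n),
        ‖c‖ = 2 * √(m * Real.pi * u - (m * Real.pi) ^ 2 * ‖x‖ ^ 2)) ∧
      ∀ c : EuclideanSpace ℝ (Fin n),
        ‖c‖ = 2 * √(m * Real.pi * u - (m * Real.pi) ^ 2 * ‖x‖ ^ 2) →
        IsGeodesicFromTo (x, 0) (x, u) (grushinCurve x 0 (2 * m * Real.pi) c) ∧
        grushinLength (grushinCurve x 0 (2 * m * Real.pi) c) =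
          ENNReal.ofReal (2 * √(m * Real.pi * u))) ∧
    -- the shortest geodesic and the Carnot-Carathéodory distance
    (∃! b : ℝ, b ∈ Ioo 0 Real.pi ∧ IsMuHatSolution x u b) ∧
    (∀ b : ℝ, b ∈ Ioo 0 Real.pi → IsMuHatSolution x u b →
      (∀ γ : ℝ → EuclideanSpace ℝ (Fin n) × ℝ, IsGeodesicFromTo (x, 0) (x, u) γ →
        ¬ EqOn γ (grushinCurveReturn x b) (Icc 0 1) →
        grushinLength (grushinCurveReturn x b) < grushinLength γ) ∧
      grushinDist (x, 0) (x, u) = grushinLength (grushinCurveReturn x b) ∧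
      grushinDist (x, 0) (x, u) = ENNReal.ofReal (b / Real.cos (b / 2) * ‖x‖) ∧
      b / Real.cos (b / 2) * ‖x‖ =
        √(2 * b * u - 2 * ‖x‖ ^ 2 * b * Real.tan (b / 2))) := by
  have hn : 0 < ‖x‖ := norm_pos_iff.2 hx
  refine ⟨isGeodesicFromTo_vertical_iff hx hu, ?_, finite_setOf_full_turns hx,
    finite_image_geodesics hx hu, fun b hb => ⟨isGeodesicFromTo_grushinCurveReturn hx hu hb, ?_,
      hb.sq_length_eq hx⟩, fun b b' hb hb' hlt => grushinLength_grushinCurveReturn_lt hx hu hb hb' hlt,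
    fun m hm hmu => ⟨?_, fun c hc => ⟨isGeodesicFromTo_grushinCurve_full_turns hm hmu hc,
      grushinLength_grushinCurve_full_turns hm hmu hc⟩⟩,
    existsUnique_isMuHatSolution hx hu, fun b hb hsol =>
      ⟨fun γ hγ hne => grushinLength_grushinCurveReturn_lt_of_ne hx hu hb hsol hγ hne,
        grushinDist_eq_grushinLength hx hu hb hsol, ?_, ?_⟩⟩
  · simp only [isMuHatSolution_iff]
    exact finite_setOf_add_sin_eq (by positivity)
  · rw [grushinLength_grushinCurveReturn (hb.pos hx hu).ne' hb.1,
      ← ENNReal.ofReal_pow (Real.sqrt_nonneg _), Real.sq_sqrt (by positivity)]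
  · refine ⟨(2 * √(m * Real.pi * u - (m * Real.pi) ^ 2 * ‖x‖ ^ 2) / ‖x‖) • x, ?_⟩
    rw [norm_smul, Real.norm_of_nonneg (by positivity), div_mul_cancel₀ _ hn.ne']
  · rw [grushinDist_eq_grushinLength hx hu hb hsol,
      grushinLength_grushinCurveReturn hb.1.ne' hsol.1, sqrt_eq_div_cos_mul_norm hb]
  · rw [← hsol.sq_length_eq hx, sqrt_eq_div_cos_mul_norm hb]
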